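/- For a word $w(x_1,\dots,x_n)$, $n\ge 1$, put $w_{\circ 1}=w$ and $w_{\circ (d+1)}(x_1,\dots,x_n)=w(w_{\circ d}(x_1,\dots,x_n),x_2,\dots,x_n)$. A group $G$ satisfies the (Engel type) iterated identity $w$ if for all $x_1,\dots,x_n\in G$ there is $N\ge 1$ with $w_{\circ N}(x_1,\dots,x_n)=e$. For such $w$, let $s(w,G)\in\mathbb N\cup\{\infty\}$ be the infimum of all integers $D$ such that for all $x_1,\dots,x_n\in G$ there is $1\le d\le D$ with $w_{\circ d}(x_1,\dots,x_n)=e$. Let $s(G)$ be the supremum of $s(w,G)$ over all iterated identities $w$ of $G$ that are non-trivial, i.e. not freely equivalent to the empty word ($s(G)=-\infty$ if there are none). $G$ is called fractal with respect to identities if $s(G)=+\infty$. The class of elementary amenable groups is the smallest class that contains all finite and all abelian groups and is closed under isomorphisms, subgroups, quotients, extensions and directed unions. Let $M_\infty$ be the group of upper unitriangular matrices $(m_{i,j})_{i,j\in\mathbb Z}$ with integer entries, only finitely many of which off the main diagonal are non-zero. Let $\phi$ be the automorphism of $M_\infty$ given by $\phi(A)_{i+1,j+1}=A_{i,j}$,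 and let $G=M_\infty\rtimes_\phi\mathbb Z$. (i) $G$ is finitely generated and elementary amenable, and it satisfies the iterated identity $\bar w(x_1,x_2,x_3)=[x_1,[x_2,x_3]]$ (for either convention, $[a,b]=aba^{-1}b^{-1}$ or $[a,b]=a^{-1}b^{-1}ab$). Every non-trivial iterated identity $w$ of $G$ has infinite depth, $s(w,G)=\infty$; in particular $G$ is fractal with respect to identities. (ii) There is a family, of the cardinality of the continuum, of pairwise non-isomorphic groups each of which is finitely generated, elementary amenable, fractal with respect to identities, and satisfies no non-trivial identity. -/

import Mathlib

noncomputable section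

/-! ### Engel-type iterated identities -/

/-- The value `w(x₁, …, xₙ)` of a word `w` in `n` letters at a tuple of elements of `G`. -/
def wordEval {n : ℕ} {G : Type*} [Group G] (w : FreeGroup (Fin n)) (x : Fin n → G) : G :=
  FreeGroup.lift x w

/-- `w` is an (ordinary) identity of `G`. -/
def SatisfiesIdentity {n : ℕ} (w : FreeGroup (Fin n)) (G : Type*) [Group G] : Prop :=
  ∀ x : Fin n → G, wordEval w x = 1

/-- The `d`-th Engel-type iteration `w(w(…w(x₁, x₂, …), x₂, …), x₂, …)` of `w` on its first
variable. A word has at least one letter, the first of them being `0 : Fin (n + 1)`. -/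
def engelIter {n : ℕ} {G : Type*} [Group G] (w : FreeGroup (Fin (n + 1)))
    (x : Fin (n + 1) → G) : ℕ → G
  | 0 => x 0
  | d + 1 => wordEval w (Function.update x 0 (engelIter w x d))

/-- `G` satisfies the Engel-type iterated identity `w`. -/
def SatisfiesIteratedIdentity {n : ℕ} (w : FreeGroup (Fin (n + 1))) (G : Type*) [Group G] :
    Prop :=
  ∀ x : Fin (n + 1) → G, ∃ N : ℕ, 1 ≤ N ∧ engelIter w x N = 1

/-- `G` has iterational depth at most `D` with respect to `w`. -/
def HasIterDepthAtMost {n : ℕ} (w : FreeGroup (Fin (n + 1))) (G : Type*) [Group G] (D : ℕ) :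
    Prop :=
  ∀ x : Fin (n + 1) → G, ∃ d : ℕ, 1 ≤ d ∧ d ≤ D ∧ engelIter w x d = 1

/-- The iterational depth `s(w, G)`: the infimum of all `D` such that `G` has iterational depth
at most `D` with respect to `w`, and `⊤` if there is no such `D`. -/
def iterDepth {n : ℕ} (w : FreeGroup (Fin (n + 1))) (G : Type*) [Group G] : ℕ∞ :=
  sInf {D : ℕ∞ | ∃ k : ℕ, D = (k : ℕ∞) ∧ HasIterDepthAtMost w G k}

/-- The iterational depth `s(G)`: the supremum of `s(w, G)` over all non-trivial iterated
identities `w` of `G`; it is `⊥` (that is, `-∞`) if there are none. -/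
def groupIterDepth (G : Type*) [Group G] : WithBot ℕ∞ :=
  sSup {s : WithBot ℕ∞ | ∃ (n : ℕ) (w : FreeGroup (Fin (n + 1))),
    w ≠ 1 ∧ SatisfiesIteratedIdentity w G ∧ s = (iterDepth w G : WithBot ℕ∞)}

/-- `G` is fractal with respect to identities: `s(G) = +∞`. -/
def IsFractalWrtIdentities (G : Type*) [Group G] : Prop :=
  groupIterDepth G = ((⊤ : ℕ∞) : WithBot ℕ∞)

/-- The commutator `a b a⁻¹ b⁻¹`. -/
def leftComm {G : Type*} [Group G] (a b : G) : G := a * b * a⁻¹ * b⁻¹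

/-- The commutator `a⁻¹ b⁻¹ a b` of the other usual convention. -/
def rightComm {G : Type*} [Group G] (a b : G) : G := a⁻¹ * b⁻¹ * a * b

/-- The word `[x₁, [x₂, x₃]]`, where `[a, b] = a b a⁻¹ b⁻¹`. -/
def commWord : FreeGroup (Fin 3) :=
  leftComm (FreeGroup.of 0) (leftComm (FreeGroup.of 1) (FreeGroup.of 2))

/-- The word `[x₁, [x₂, x₃]]`, where `[a, b] = a⁻¹ b⁻¹ a b`. -/
def commWord' : FreeGroup (Fin 3) :=
  rightComm (FreeGroup.of 0) (rightComm (FreeGroup.of 1) (FreeGroup.of 2))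

/-! ### Elementary amenable groups -/

/-- The elementary amenable groups: the smallest class of groups that contains the finite and the
abelian groups and is closed under isomorphisms, subgroups, quotients, extensions and
directed unions. -/
inductive IsElementaryAmenable : (G : Type) → [Group G] → Prop
  | of_finite (G : Type) [Group G] [Finite G] : IsElementaryAmenable G
  | of_comm (G : Type) [Group G] (h : ∀ a b : G, a * b = b * a) : IsElementaryAmenable G
  | of_mulEquiv (G H : Type) [Group G] [Group H] (e : G ≃* H) (h : IsElementaryAmenable G) :
      IsElementaryAmenable H
  | subgroup (G : Type) [Group G] (H : Subgroup G) (h : IsElementaryAmenable G) :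
      IsElementaryAmenable H
  | quotient (G : Type) [Group G] (N : Subgroup G) [N.Normal] (h : IsElementaryAmenable G) :
      IsElementaryAmenable (G ⧸ N)
  | extension (G : Type) [Group G] (N : Subgroup G) [N.Normal] (hN : IsElementaryAmenable N)
      (hQ : IsElementaryAmenable (G ⧸ N)) : IsElementaryAmenable G
  | directedUnion (G : Type) [Group G] (S : Set (Subgroup G)) (hne : S.Nonempty)
      (hdir : DirectedOn (· ≤ ·) S) (hS : ∀ H ∈ S, IsElementaryAmenable H)
      (htop : ∀ g : G, ∃ H ∈ S, g ∈ H) : IsElementaryAmenable G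

/-! ### Infinite unitriangular matrices and their extension by the shift -/

/-- The ring of upper triangular `ℤ × ℤ` matrices with integer entries. The product is the usual
matrix product: `(A * B) i j = ∑ k ∈ [i, j], A i k * B k j`. -/
abbrev UpperTriangular : Type := IncidenceAlgebra ℤ ℤ

/-- The group `M_∞` of upper unitriangular `ℤ × ℤ` matrices with integer entries, only finitely
many of which off the main diagonal are non-zero. -/
def UniTri : Subgroup UpperTriangularˣ where
  carrier := {u | (∀ i : ℤ, (u : UpperTriangular) i i = 1) ∧
    {p : ℤ × ℤ | p.1 ≠ p.2 ∧ (u : UpperTriangular) p.1 p.2 ≠ 0}.Finite}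
  one_mem' := by
    refine ⟨fun i => by simp, ?_⟩
    convert Set.finite_empty
    ext ⟨a, b⟩
    simp +contextual
  mul_mem' := by
    rintro u v ⟨hu1, hu2⟩ ⟨hv1, hv2⟩
    refine ⟨fun i => by simp [hu1, hv1], ?_⟩
    refine ((hu2.image Prod.fst).union (hv2.image Prod.fst)).prod
      ((hu2.image Prod.snd).union (hv2.image Prod.snd)) |>.subset ?_
    rintro ⟨a, b⟩ ⟨hab, hne⟩
    simp only [ne_eq] at hab
    simp only [Units.val_mul, IncidenceAlgebra.mul_apply] at hne
    obtain ⟨x, hx, hx0⟩ := Finset.exists_ne_zero_of_sum_ne_zero hne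
    have h1 : (u : UpperTriangular) a x ≠ 0 := left_ne_zero_of_mul hx0
    have h2 : (v : UpperTriangular) x b ≠ 0 := right_ne_zero_of_mul hx0
    refine ⟨?_, ?_⟩
    · by_cases hax : a = x
      · subst hax
        exact Or.inr ⟨(a, b), ⟨hab, h2⟩, rfl⟩
      · exact Or.inl ⟨(a, x), ⟨hax, h1⟩, rfl⟩
    · by_cases hxb : x = b
      · subst hxb
        exact Or.inl ⟨(a, x), ⟨hab, h1⟩, rfl⟩
      · exact Or.inr ⟨(x, b), ⟨hxb, h2⟩, rfl⟩
  inv_mem' := by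
    rintro u ⟨hu1, hu2⟩
    have hl : ∀ a b : ℤ, ∑ x ∈ Finset.Icc a b,
        (u⁻¹ : UpperTriangularˣ).val a x * u.val x b = if a = b then 1 else 0 := fun a b => by
      rw [← IncidenceAlgebra.mul_apply, Units.inv_mul, IncidenceAlgebra.one_apply]
    have hr : ∀ a b : ℤ, ∑ x ∈ Finset.Icc a b,
        u.val a x * (u⁻¹ : UpperTriangularˣ).val x b = if a = b then 1 else 0 := fun a b => by
      rw [← IncidenceAlgebra.mul_apply, Units.mul_inv, IncidenceAlgebra.one_apply]
    refine ⟨fun i => by simpa [hu1] using hl i i, ?_⟩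
    refine (hu2.image Prod.fst).prod (hu2.image Prod.snd) |>.subset ?_
    rintro ⟨a, b⟩ ⟨hab, hne⟩
    simp only [ne_eq] at hab hne
    have hle : a ≤ b := IncidenceAlgebra.le_of_ne_zero hne
    refine ⟨?_, ?_⟩
    · by_contra hcon
      apply hne
      have hz : ∀ x, x ≠ a → u.val a x = 0 := fun x hx => by
        by_contra h0
        exact hcon ⟨(a, x), ⟨fun h => hx h.symm, h0⟩, rfl⟩
      have h := hr a b
      rw [Finset.sum_eq_single a (fun x _ hx => by rw [hz x hx, zero_mul])
        (fun h => absurd (Finset.mem_Icc.2 ⟨le_rfl, hle⟩) h), hu1, one_mul, if_neg hab] at h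
      exact h
    · by_contra hcon
      apply hne
      have hz : ∀ x, x ≠ b → u.val x b = 0 := fun x hx => by
        by_contra h0
        exact hcon ⟨(x, b), ⟨hx, h0⟩, rfl⟩
      have h := hl a b
      rw [Finset.sum_eq_single b (fun x _ hx => by rw [hz x hx, mul_zero])
        (fun h => absurd (Finset.mem_Icc.2 ⟨hle, le_rfl⟩) h), hu1, mul_one, if_neg hab] at h
      exact h

/-- Translation of a matrix along the diagonal by `k`: the new `(i, j)` entry is the old
`(i - k, j - k)` entry. -/
def translateDiag (k : ℤ) (A : UpperTriangular) : UpperTriangular :=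
  ⟨fun i j => A (i - k) (j - k), fun i j h =>
    IncidenceAlgebra.apply_eq_zero_of_not_le (by omega) A⟩

theorem translateDiag_apply (k : ℤ) (A : UpperTriangular) (i j : ℤ) :
    translateDiag k A i j = A (i - k) (j - k) := rfl

theorem translateDiag_mul (k : ℤ) (A B : UpperTriangular) :
    translateDiag k (A * B) = translateDiag k A * translateDiag k B := by
  ext i j
  simp only [translateDiag_apply, IncidenceAlgebra.mul_apply]
  refine Finset.sum_bij' (fun x _ => x + k) (fun x _ => x - k) ?_ ?_ ?_ ?_ ?_
  all_goals intro x hx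
  all_goals simp only [Finset.mem_Icc] at hx
  all_goals first
    | (simp only [Finset.mem_Icc]; omega)
    | simp

/-- The ring of upper triangular matrices is acted on by the shift `(i, j) ↦ (i + 1, j + 1)`. -/
def shiftUpper : UpperTriangular ≃* UpperTriangular where
  toFun := translateDiag 1
  invFun := translateDiag (-1)
  left_inv A := by ext i j _; simp [translateDiag_apply]
  right_inv A := by ext i j _; simp [translateDiag_apply]
  map_mul' := translateDiag_mul 1

theorem translateDiag_mem_aux {u v : UpperTriangularˣ} {k : ℤ}
    (h : (v : UpperTriangular) = translateDiag k u) (hu : u ∈ UniTri) : v ∈ UniTri := by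
  refine ⟨fun i => by rw [h, translateDiag_apply]; exact hu.1 _, ?_⟩
  refine (hu.2.image (fun p => (p.1 + k, p.2 + k))).subset ?_
  rintro ⟨a, b⟩ ⟨hab, hne⟩
  rw [h, translateDiag_apply] at hne
  exact ⟨(a - k, b - k), ⟨by simpa using hab, hne⟩, by simp⟩

/-- The shift automorphism `φ` of `M_∞`: the `(i + 1, j + 1)` entry of `φ(A)` is the `(i, j)`
entry of `A`. -/
def shiftAut : MulAut UniTri where
  toFun u := ⟨Units.mapEquiv shiftUpper u.1, translateDiag_mem_aux (k := 1) rfl u.2⟩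
  invFun u := ⟨Units.mapEquiv shiftUpper.symm u.1, translateDiag_mem_aux (k := -1) rfl u.2⟩
  left_inv u := by
    apply Subtype.ext
    apply Units.ext
    exact shiftUpper.left_inv _
  right_inv u := by
    apply Subtype.ext
    apply Units.ext
    exact shiftUpper.right_inv _
  map_mul' u v := by
    apply Subtype.ext
    exact map_mul (Units.mapEquiv shiftUpper) u.1 v.1

/-- The extension `G = M_∞ ⋊ ℤ` of `M_∞` by an infinite cyclic group whose generator acts on
`M_∞` by the shift. -/
abbrev ShiftExtension : Type :=
  UniTri ⋊[zpowersHom (MulAut UniTri) shiftAut] Multiplicative ℤ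

end

noncomputable section

open scoped commutatorElement

/-! ### Unipotent matrices -/

namespace UniTri

/-! The group `M_∞` discriminates free groups: one homomorphism can keep any finite set of
non-trivial elements alive (`UniTri.exists_hom_ne_one`). Write each element as a product of
syllables `x_i ^ k` and lay out its sequence of letters along the first superdiagonal. If `x_i` is
sent to `1 + N_i`, with `N_i` supported on the places labelled `i`, then some entry of the image is
the product of the exponents.

A bound `D` on the depth concerns only the iterates `w_{∘1}, …, w_{∘D}`. These are non-trivial in
the free group (`engelIter_of_ne_one`). Either `w` does not involve `x₁` and every iterate is `w`,
or `x₁ ↦ w` extends to an endomorphism `θ` fixing the other letters, with `w_{∘d} = θ^d(x₁)`. By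
Nielsen–Schreier and the Hopf property `θ` is injective. Hence every group containing `M_∞` has
infinite depth for every non-trivial word, and satisfies no non-trivial identity.

The commutators of `G` lie in `M_∞`, a directed union of nilpotent blocks. Thus `y ↦ [y, c]` with `c
= [x₂, x₃]` eventually reaches `1`. The blocks also give elementary amenability.

For the continuum, `G` is multiplied by a group of P. Hall type: a central extension of `⨁_ℤ ℤ` by
`Z = ⨁_{p ∈ S} ℤ/p`, extended by the shift. It is finitely generated because commutators of the `eᵢ`
generate `Z`. The shift has no other fixed points that could contribute central torsion, so the set
of primes `S` is an isomorphism invariant. -/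

theorem ext_apply {u v : UniTri}
    (h : ∀ i j, i ≤ j → (u : UpperTriangularˣ).val i j = (v : UpperTriangularˣ).val i j) :
    u = v := by
  apply Subtype.ext
  apply Units.ext
  ext i j hij
  exact h i j hij

theorem coe_inv_mul (u : UniTri) : ((u⁻¹ : UniTri) : UpperTriangularˣ).val * u.1.val = 1 := by
  rw [← Units.val_mul, ← Subgroup.coe_mul, inv_mul_cancel]; rfl

theorem mul_coe_inv (u : UniTri) : u.1.val * ((u⁻¹ : UniTri) : UpperTriangularˣ).val = 1 := by
  rw [← Units.val_mul, ← Subgroup.coe_mul, mul_inv_cancel]; rfl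

/-- The one-parameter subgroup `a ↦ 1 + a X` of `M_∞`, where `X² = 0`. -/
def unipotent (X : UpperTriangular) (hX : X * X = 0)
    (hfin : {p : ℤ × ℤ | X p.1 p.2 ≠ 0}.Finite) : Multiplicative ℤ →* UniTri where
  toFun a := ⟨⟨1 + a.toAdd • X, 1 - a.toAdd • X,
      by simp only [mul_sub, add_mul, smul_mul_smul_comm, hX, smul_zero, one_mul, mul_one]; abel,
      by simp only [mul_add, sub_mul, smul_mul_smul_comm, hX, smul_zero, one_mul, mul_one]; abel⟩, by
    -- By triangularity the diagonal entry of `X * X` is `(X i i) ^ 2`.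
    have hd : ∀ i, X i i = 0 := fun i => by
      have := congrArg (fun A : UpperTriangular => A i i) hX
      simpa using this
    have key : ∀ i j, (1 + a.toAdd • X) i j = (if i = j then 1 else 0) + a.toAdd * X i j :=
      fun i j => rfl
    refine ⟨fun i => by rw [key, hd, if_pos rfl, mul_zero, add_zero], hfin.subset ?_⟩
    rintro ⟨i, j⟩ ⟨hij, hne⟩ h0
    simp only [ne_eq] at hij h0
    exact hne (by rw [key, if_neg hij, h0, mul_zero, add_zero])⟩
  map_one' := by
    apply Subtype.ext
    apply Units.ext
    simp
  map_mul' a b := by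
    apply Subtype.ext
    apply Units.ext
    simp only [toAdd_mul, Subgroup.coe_mul, Units.val_mul, mul_add, add_mul, smul_mul_smul_comm, hX,
      add_smul, smul_zero, one_mul, mul_one]
    abel

theorem unipotent_val (X : UpperTriangular) (hX : X * X = 0)
    (hfin : {p : ℤ × ℤ | X p.1 p.2 ≠ 0}.Finite) (a : Multiplicative ℤ) :
    (unipotent X hX hfin a).1.val = 1 + a.toAdd • X := rfl

/-- The matrix whose only non-zero entry is a `1` at the place `(i, j)`, where `i < j`; it is
zero if `j ≤ i`. -/
def matrixUnit (i j : ℤ) : UpperTriangular :=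
  ⟨fun p q => if p = i ∧ q = j ∧ i < j then 1 else 0, fun p q h => by
    rw [if_neg]
    rintro ⟨rfl, rfl, h'⟩
    exact h h'.le⟩

theorem matrixUnit_apply (i j p q : ℤ) :
    matrixUnit i j p q = if p = i ∧ q = j ∧ i < j then 1 else 0 := rfl

theorem matrixUnit_mul_apply (i j : ℤ) (A : UpperTriangular) (p q : ℤ) :
    (matrixUnit i j * A) p q = if p = i ∧ i < j then A j q else 0 := by
  rw [IncidenceAlgebra.mul_apply]
  simp only [matrixUnit_apply]
  by_cases h : p = i ∧ i < j
  · obtain ⟨rfl, hij⟩ := h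
    rw [if_pos ⟨rfl, hij⟩]
    by_cases hjq : j ≤ q
    · rw [Finset.sum_eq_single j]
      · simp [hij]
      · intro b _ hb
        simp [hb]
      · intro hj
        exact absurd (Finset.mem_Icc.2 ⟨hij.le, hjq⟩) hj
    · rw [IncidenceAlgebra.apply_eq_zero_of_not_le hjq]
      refine Finset.sum_eq_zero fun x hx => ?_
      rw [if_neg, zero_mul]
      rintro ⟨_, rfl, _⟩
      exact hjq (Finset.mem_Icc.1 hx).2
  · rw [if_neg h]
    refine Finset.sum_eq_zero fun x hx => ?_
    rw [if_neg, zero_mul]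
    rintro ⟨h1, _, h2⟩
    exact h ⟨h1, h2⟩

theorem matrixUnit_mul_matrixUnit (i j k l : ℤ) :
    matrixUnit i j * matrixUnit k l =
      if j = k ∧ i < j ∧ k < l then matrixUnit i l else 0 := by
  ext p q _
  rw [matrixUnit_mul_apply, matrixUnit_apply]
  split_ifs with h1 h2 h3 h3 h3
  all_goals simp only [matrixUnit_apply, IncidenceAlgebra.zero_apply]
  all_goals grind

/-- The one-parameter subgroup of elementary matrices of position `(i, j)`. -/
def elementary (i j : ℤ) : Multiplicative ℤ →* UniTri :=
  unipotent (matrixUnit i j)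
    (by rw [matrixUnit_mul_matrixUnit, if_neg (by omega)])
    ((Set.finite_singleton (i, j)).subset fun p hp => by
      simp only [matrixUnit_apply, ne_eq, ite_eq_right_iff, not_forall, Set.mem_ofPred_eq] at hp
      obtain ⟨⟨h1, h2, _⟩, _⟩ := hp
      exact Prod.ext h1 h2)

theorem elementary_val (i j : ℤ) (a : Multiplicative ℤ) :
    (elementary i j a).1.val = 1 + a.toAdd • matrixUnit i j := rfl

theorem shiftAut_elementary (i j : ℤ) (a : Multiplicative ℤ) :
    shiftAut (elementary i j a) = elementary (i + 1) (j + 1) a := by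
  refine ext_apply fun p q _ => ?_
  change translateDiag 1 (elementary i j a).1.val p q = _
  simp only [translateDiag_apply, elementary_val, IncidenceAlgebra.add_apply,
    IncidenceAlgebra.constSMul_apply, matrixUnit_apply, IncidenceAlgebra.one_apply, sub_left_inj,
    add_lt_add_iff_right]
  simp only [sub_eq_iff_eq_add]

/-- Steinberg's commutator relation, free of inverses so that it can be checked by multiplying out.
-/
theorem commutator_elementary {i j k : ℤ} (hij : i < j) (hjk : j < k) (a b : Multiplicative ℤ) :
    elementary i j a * elementary j k b =
      elementary i k (Multiplicative.ofAdd (a.toAdd * b.toAdd)) *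
        (elementary j k b * elementary i j a) := by
  apply Subtype.ext
  apply Units.ext
  simp only [Subgroup.coe_mul, Units.val_mul, elementary_val, toAdd_ofAdd, mul_add, add_mul, one_mul,
    mul_one, smul_mul_smul_comm, matrixUnit_mul_matrixUnit]
  simp only [hij, hjk, (hij.trans hjk).ne', hjk.ne', and_self, if_true, false_and, if_false,
    smul_zero, add_zero, mul_zero]
  abel

/-- A subgroup that contains all elementary matrices is the whole group: clear the entries one by
one, starting in the lowest non-trivial row. -/
theorem eq_top_of_elementary_mem {S : Subgroup UniTri}
    (hS : ∀ i j a, i < j → elementary i j a ∈ S) : S = ⊤ := by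
  rw [Subgroup.eq_top_iff']
  suffices H : ∀ (n : ℕ) (u : UniTri),
      {p : ℤ × ℤ | p.1 ≠ p.2 ∧ u.1.val p.1 p.2 ≠ 0}.ncard = n → u ∈ S from fun u => H _ u rfl
  intro n
  induction n with
  | zero =>
    intro u hu
    rw [Set.ncard_eq_zero u.2.2] at hu
    have : u = 1 := ext_apply fun i j hij => by
      by_cases h : i = j
      · subst h
        rw [u.2.1]
        simp
      · have h0 : (i, j) ∉ {p : ℤ × ℤ | p.1 ≠ p.2 ∧ u.1.val p.1 p.2 ≠ 0} := by
          rw [hu]; exact Set.notMem_empty _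
        have h1 : u.1.val i j = 0 := by
          by_contra h1
          exact h0 ⟨h, h1⟩
        rw [h1]
        simp [h]
    rw [this]
    exact S.one_mem
  | succ n ih =>
    intro u hu
    have hne : {p : ℤ × ℤ | p.1 ≠ p.2 ∧ u.1.val p.1 p.2 ≠ 0}.Nonempty := by
      rw [← Set.ncard_pos u.2.2]; omega
    obtain ⟨⟨i, j⟩, ⟨hij, huij⟩, hmax⟩ := Set.exists_max_image _ Prod.fst u.2.2 hne
    simp only [ne_eq] at hij huij
    have hlt : i < j := lt_of_le_of_ne (IncidenceAlgebra.le_of_ne_zero huij) hij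
    have hrow : ∀ q, u.1.val j q = if j = q then 1 else 0 := fun q => by
      split_ifs with h
      · rw [← h, u.2.1]
      · by_contra h0
        exact absurd (hmax (j, q) ⟨h, h0⟩) (not_le.2 hlt)
    set a : ℤ := u.1.val i j with ha
    -- The product adds `-a` times row `j` to row `i`. As row `j` is trivial, only the entry `(i,
    -- j)` changes.
    have hval : ∀ p q, (elementary i j (Multiplicative.ofAdd (-a)) * u).1.val p q =
        u.1.val p q - if p = i ∧ q = j then a else 0 := fun p q => by
      rw [Subgroup.coe_mul, Units.val_mul, elementary_val, add_mul, one_mul, smul_mul_assoc,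
        IncidenceAlgebra.add_apply, IncidenceAlgebra.constSMul_apply, matrixUnit_mul_apply, hrow,
        toAdd_ofAdd]
      simp only [eq_comm (a := q), hlt, and_true, ite_and]
      split_ifs <;> simp [sub_eq_add_neg]
    have hmem := ih (elementary i j (Multiplicative.ofAdd (-a)) * u) (by
      have : {p : ℤ × ℤ | p.1 ≠ p.2 ∧
          (elementary i j (Multiplicative.ofAdd (-a)) * u).1.val p.1 p.2 ≠ 0} =
          {p : ℤ × ℤ | p.1 ≠ p.2 ∧ u.1.val p.1 p.2 ≠ 0} \ {(i, j)} := by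
        ext ⟨p, q⟩
        simp only [hval, Set.mem_ofPred_eq, Set.mem_sdiff, Set.mem_singleton_iff, Prod.mk.injEq]
        by_cases h : p = i ∧ q = j
        · rw [if_pos h, h.1, h.2]
          simp [ha]
        · simp [h]
      have hmem : (i, j) ∈ {p : ℤ × ℤ | p.1 ≠ p.2 ∧ u.1.val p.1 p.2 ≠ 0} := ⟨hij, huij⟩
      rw [this, Set.ncard_sdiff_singleton_of_mem hmem, hu, Nat.add_sub_cancel])
    exact (Subgroup.mul_mem_cancel_left S (hS i j _ hlt)).1 hmem

/-- An elementary matrix next to the diagonal generates `M_∞` under the shift. -/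
theorem eq_top_of_shift_mem {S : Subgroup UniTri}
    (h0 : elementary 0 1 (Multiplicative.ofAdd 1) ∈ S)
    (hshift : ∀ u, u ∈ S ↔ shiftAut u ∈ S) : S = ⊤ := by
  have h1 : ∀ i : ℤ, elementary i (i + 1) (Multiplicative.ofAdd 1) ∈ S := fun i => by
    induction i using Int.induction_on with
    | zero => simpa using h0
    | succ i ih => rwa [hshift, shiftAut_elementary] at ih
    | pred i ih =>
      rw [hshift, shiftAut_elementary]
      simpa using ih
  -- Higher superdiagonals arise from commutators with elements of the first one.
  have h2 : ∀ (n : ℕ) (i : ℤ), elementary i (i + n + 1) (Multiplicative.ofAdd 1) ∈ S := fun n => by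
    induction n with
    | zero => simpa using h1
    | succ n ih =>
      intro i
      have := commutator_elementary (i := i) (j := i + n + 1) (k := i + (n + 1 : ℕ) + 1) (by omega)
        (by push_cast; omega) (Multiplicative.ofAdd 1) (Multiplicative.ofAdd 1)
      rw [toAdd_ofAdd, mul_one, ← mul_inv_eq_iff_eq_mul] at this
      have hk : elementary (i + n + 1) (i + (n + 1 : ℕ) + 1) (Multiplicative.ofAdd 1) ∈ S := by
        have := h1 (i + n + 1)
        push_cast
        rwa [← add_assoc]
      rw [← this]
      exact S.mul_mem (S.mul_mem (ih i) hk) (S.inv_mem (S.mul_mem hk (ih i)))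
  refine eq_top_of_elementary_mem fun i j a hij => ?_
  have ha : a = Multiplicative.ofAdd 1 ^ a.toAdd := by
    rw [← ofAdd_zsmul]; simp
  rw [ha, map_zpow]
  have := h2 (j - i - 1).toNat i
  rw [Int.toNat_of_nonneg (by omega)] at this
  refine S.zpow_mem ?_ _
  rwa [show i + (j - i - 1) + 1 = j by ring] at this

/-! ### Nilpotency of the finite blocks -/

theorem mul_apply_of_row (A B : UpperTriangular) {i : ℤ}
    (h : ∀ j, A i j = (1 : UpperTriangular) i j) (j : ℤ) : (A * B) i j = B i j := by
  nth_rewrite 2 [← one_mul B]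
  simp only [IncidenceAlgebra.mul_apply, h]

theorem mul_apply_of_column (A B : UpperTriangular) {j : ℤ}
    (h : ∀ i, B i j = (1 : UpperTriangular) i j) (i : ℤ) : (A * B) i j = A i j := by
  nth_rewrite 2 [← mul_one A]
  simp only [IncidenceAlgebra.mul_apply, h]

/-- The matrices that coincide with the identity matrix outside of the block `[-n, n]²`. -/
def block (n : ℕ) : Subgroup UniTri where
  carrier := {u | (∀ i j : ℤ, i < -n → u.1.val i j = (1 : UpperTriangular) i j) ∧
    ∀ i j : ℤ, n < j → u.1.val i j = (1 : UpperTriangular) i j}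
  one_mem' := ⟨fun _ _ _ => rfl, fun _ _ _ => rfl⟩
  mul_mem' := by
    rintro u v ⟨hu1, hu2⟩ ⟨hv1, hv2⟩
    refine ⟨fun i j hi => ?_, fun i j hj => ?_⟩
    · rw [← hv1 i j hi]
      exact mul_apply_of_row _ _ (hu1 i · hi) j
    · rw [← hu2 i j hj]
      exact mul_apply_of_column _ _ (hv2 · j hj) i
  inv_mem' := by
    rintro u ⟨hu1, hu2⟩
    refine ⟨fun i j hi => ?_, fun i j hj => ?_⟩
    · rw [← mul_coe_inv u]
      exact (mul_apply_of_row _ _ (hu1 i · hi) j).symm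
    · rw [← coe_inv_mul u]
      exact (mul_apply_of_column _ _ (hu2 · j hj) i).symm

theorem block_mono {m n : ℕ} (h : m ≤ n) : block m ≤ block n :=
  fun _ hu => ⟨fun i j hi => hu.1 i j (by omega), fun i j hj => hu.2 i j (by omega)⟩

theorem exists_mem_block (u : UniTri) : ∃ n, u ∈ block n := by
  obtain ⟨a, ha⟩ := (u.2.2.image Prod.fst).bddBelow
  obtain ⟨b, hb⟩ := (u.2.2.image Prod.snd).bddAbove
  have key : ∀ i j, i < a ∨ b < j → u.1.val i j = (1 : UpperTriangular) i j := fun i j h => by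
    by_cases hij : i = j
    · subst hij
      rw [u.2.1]
      simp
    · rw [IncidenceAlgebra.one_apply, if_neg hij]
      by_contra h0
      have h1 := ha ⟨(i, j), ⟨hij, h0⟩, rfl⟩
      have h2 := hb ⟨(i, j), ⟨hij, h0⟩, rfl⟩
      simp only at h1 h2
      omega
  exact ⟨max a.natAbs b.natAbs, fun i j hi => key i j (by omega), fun i j hj => key i j (by omega)⟩

/-- The matrices with no non-zero entry `(i, j)` such that `j < i + k`. -/
def IsAbove (k : ℕ) (X : UpperTriangular) : Prop := ∀ i j : ℤ, j < i + k → X i j = 0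

theorem IsAbove.mul {k l : ℕ} {X Y : UpperTriangular} (hX : IsAbove k X) (hY : IsAbove l Y) :
    IsAbove (k + l) (X * Y) := fun i j hij => by
  rw [IncidenceAlgebra.mul_apply]
  refine Finset.sum_eq_zero fun x _ => ?_
  by_cases h : x < i + k
  · rw [hX i x h, zero_mul]
  · rw [hY x j (by push_cast at hij; omega), mul_zero]

theorem IsAbove.add {k : ℕ} {X Y : UpperTriangular} (hX : IsAbove k X) (hY : IsAbove k Y) :
    IsAbove k (X + Y) := fun i j hij => by
  rw [IncidenceAlgebra.add_apply, hX i j hij, hY i j hij, add_zero]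

theorem IsAbove.neg {k : ℕ} {X : UpperTriangular} (hX : IsAbove k X) : IsAbove k (-X) :=
  fun i j hij => by rw [IncidenceAlgebra.neg_apply, hX i j hij, neg_zero]

theorem isAbove_zero (X : UpperTriangular) : IsAbove 0 X := fun i j hij =>
  IncidenceAlgebra.apply_eq_zero_of_not_le (by simpa using hij) X

theorem isAbove_one_sub_one (u : UniTri) : IsAbove 1 (u.1.val - 1) := fun i j hij => by
  rw [IncidenceAlgebra.sub_apply, IncidenceAlgebra.one_apply]
  rcases lt_or_eq_of_le (show j ≤ i by push_cast at hij; omega) with h | rfl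
  · rw [IncidenceAlgebra.apply_eq_zero_of_not_le (not_le.2 h), if_neg h.ne', sub_zero]
  · rw [u.2.1, if_pos rfl, sub_self]

/-- The lower central filtration of `M_∞`. -/
def filtration (k : ℕ) : Subgroup UniTri where
  carrier := {u | IsAbove k (u.1.val - 1)}
  one_mem' := fun i j _ => by simp
  mul_mem' := by
    intro u v hu hv
    have : (u * v).1.val - 1 = (u.1.val - 1) * v.1.val + (v.1.val - 1) := by
      rw [Subgroup.coe_mul, Units.val_mul, sub_mul, one_mul, sub_add_sub_cancel]
    change IsAbove k _
    rw [this]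
    exact (IsAbove.mul hu (isAbove_zero _)).add hv
  inv_mem' := by
    intro u hu
    have : (u⁻¹).1.val - 1 = -((u.1.val - 1) * (u⁻¹).1.val) := by
      rw [sub_mul, one_mul, mul_coe_inv, neg_sub]
    change IsAbove k _
    rw [this]
    exact (IsAbove.mul hu (isAbove_zero _)).neg

/-- With `X = u - 1` and `Y = v - 1` one has `[u, v] - 1 = (XY - YX)(vu)⁻¹`, and `Y` raises the
degree by at least one. -/
theorem commutator_mem_filtration {k : ℕ} {u : UniTri} (hu : u ∈ filtration k) (v : UniTri) :
    ⁅u, v⁆ ∈ filtration (k + 1) := by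
  have hu' : IsAbove k (u.1.val - 1) := hu
  have key : (⁅u, v⁆).1.val - 1 = ((u.1.val - 1) * (v.1.val - 1) +
      -((v.1.val - 1) * (u.1.val - 1))) * ((v * u)⁻¹).1.val := by
    have h1 : ⁅u, v⁆ = u * v * (v * u)⁻¹ := by rw [commutatorElement_def]; group
    have h2 := mul_coe_inv (v * u)
    rw [Subgroup.coe_mul, Units.val_mul] at h2
    rw [h1, Subgroup.coe_mul, Units.val_mul, Subgroup.coe_mul, Units.val_mul]
    nth_rewrite 1 [← h2]
    rw [← sub_mul]
    congr 1
    simp only [sub_mul, mul_sub, one_mul, mul_one]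
    abel
  change IsAbove (k + 1) _
  rw [key]
  refine IsAbove.mul (l := 0) (.add (hu'.mul (isAbove_one_sub_one v)) ?_) (isAbove_zero _)
  rw [add_comm]
  exact ((isAbove_one_sub_one v).mul hu').neg

/-- Inside the block `j - i ≤ 2n`, so `filtration (2 * n + 1)` meets it trivially. The series starts
at `filtration 1`, which is everything. -/
instance isNilpotent_block (n : ℕ) : Group.IsNilpotent (block n) := by
  rw [Subgroup.nilpotent_iff_finite_descending_central_series]
  refine ⟨2 * n, fun k => (filtration (k + 1)).comap (block n).subtype, ⟨?_, ?_⟩, ?_⟩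
  · rw [Subgroup.eq_top_iff']
    exact fun u => isAbove_one_sub_one u.1
  · intro x k hx g
    have := commutator_mem_filtration hx g.1
    rwa [Subgroup.mem_comap, map_commutatorElement]
  · rw [Subgroup.eq_bot_iff_forall]
    intro u hu
    apply Subtype.ext
    refine ext_apply fun i j hij => ?_
    have hu' : IsAbove (2 * n + 1) (u.1.1.val - 1) := hu
    by_cases h1 : i < -n
    · exact u.2.1 i j h1
    by_cases h2 : n < j
    · exact u.2.2 i j h2
    have := hu' i j (by push_cast; omega)
    rw [IncidenceAlgebra.sub_apply, sub_eq_zero] at this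
    exact this

end UniTri

/-! ### Free groups are discriminated by `M_∞` -/

/-- A non-trivial element of a free group is a product of powers of generators, adjacent ones being
distinct. -/
theorem FreeGroup.exists_syllables {ι : Type*} {g : FreeGroup ι} (hg : g ≠ 1) :
    ∃ l : List (ι × ℤ), l ≠ [] ∧ (∀ x ∈ l, x.2 ≠ 0) ∧ (l.map Prod.fst).IsChain (· ≠ ·) ∧
      g = (l.map fun x => FreeGroup.of x.1 ^ x.2).prod := by
  classical
  -- The syllables are the letters of the normal form in a free product of infinite cyclic groups.
  have hexp : ∀ m : FreeGroup Unit, ∃ k : ℤ, m = FreeGroup.of () ^ k := fun m =>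
    ⟨FreeGroup.freeGroupUnitEquivInt m, (FreeGroup.freeGroupUnitEquivInt.symm_apply_apply m).symm⟩
  choose e he using hexp
  obtain ⟨w, hw⟩ : ∃ w : Monoid.CoprodI.Word (fun _ : ι => FreeGroup Unit),
      w.prod = freeGroupEquivCoprodI g :=
    ⟨Monoid.CoprodI.Word.equiv (freeGroupEquivCoprodI g),
      Monoid.CoprodI.Word.equiv.symm_apply_apply _⟩
  refine ⟨w.toList.map fun x => (x.1, e x.2), ?_, ?_, ?_, ?_⟩
  · intro h
    rw [List.map_eq_nil_iff] at h
    apply hg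
    rw [← map_eq_one_iff freeGroupEquivCoprodI freeGroupEquivCoprodI.injective, ← hw,
      Monoid.CoprodI.Word.prod, h]
    rfl
  · simp only [List.mem_map, forall_exists_index, and_imp, forall_apply_eq_imp_iff₂]
    intro x hx h0
    apply w.ne_one x hx
    rw [he x.2, h0, zpow_zero]
  · rw [List.map_map, List.isChain_map]
    exact w.chain_ne
  · apply freeGroupEquivCoprodI.injective
    rw [← hw, map_list_prod, Monoid.CoprodI.Word.prod, List.map_map, List.map_map]
    congr 1
    refine List.map_congr_left fun x _ => ?_
    simp only [Function.comp_apply, map_zpow, freeGroupEquivCoprodI_apply, FreeGroup.lift_apply_of]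
    rw [← map_zpow, ← he]

namespace UniTri

variable {ι : Type*}

open Classical in
/-- The matrix with entries `1` at the places `(p, p + 1)` with label `i`. -/
def labelMatrix (c : ℤ → Option ι) (i : ι) : UpperTriangular :=
  ⟨fun p q => if q = p + 1 ∧ c p = some i then 1 else 0, fun p q h => by
    rw [if_neg]
    rintro ⟨rfl, -⟩
    exact h (by omega)⟩

open Classical in
theorem labelMatrix_apply (c : ℤ → Option ι) (i : ι) (p q : ℤ) :
    labelMatrix c i p q = if q = p + 1 ∧ c p = some i then 1 else 0 := rfl

open Classical in
theorem labelMatrix_mul_apply (c : ℤ → Option ι) (i : ι) (A : UpperTriangular) (p q : ℤ) :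
    (labelMatrix c i * A) p q = if c p = some i then A (p + 1) q else 0 := by
  rw [IncidenceAlgebra.mul_apply]
  simp only [labelMatrix_apply]
  split_ifs with h
  · by_cases hq : p + 1 ≤ q
    · rw [Finset.sum_eq_single (p + 1)]
      · simp [h]
      · intro b _ hb
        simp [hb]
      · intro hj
        exact absurd (Finset.mem_Icc.2 ⟨by omega, hq⟩) hj
    · rw [IncidenceAlgebra.apply_eq_zero_of_not_le hq]
      refine Finset.sum_eq_zero fun x hx => ?_
      rw [if_neg, zero_mul]
      rintro ⟨rfl, _⟩
      exact hq (Finset.mem_Icc.1 hx).2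
  · refine Finset.sum_eq_zero fun x hx => ?_
    rw [if_neg (fun h' => h h'.2), zero_mul]

/-- A labelling of the places next to the diagonal, where no two adjacent places carry the same
label and only finitely many places carry a label. -/
structure IsLabelling (c : ℤ → Option ι) : Prop where
  finite : {p | c p ≠ none}.Finite
  ne_succ : ∀ p i, c p = some i → c (p + 1) ≠ some i

theorem IsLabelling.labelMatrix_mul_self {c : ℤ → Option ι} (hc : IsLabelling c) (i : ι) :
    labelMatrix c i * labelMatrix c i = 0 := by
  ext p q _
  rw [labelMatrix_mul_apply, labelMatrix_apply, IncidenceAlgebra.zero_apply]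
  split_ifs with h1 h2
  · exact absurd h2.2 (hc.ne_succ p i h1)
  · rfl
  · rfl

theorem IsLabelling.labelMatrix_finite {c : ℤ → Option ι} (hc : IsLabelling c) (i : ι) :
    {p : ℤ × ℤ | labelMatrix c i p.1 p.2 ≠ 0}.Finite := by
  refine (hc.finite.image fun p => (p, p + 1)).subset ?_
  rintro ⟨p, q⟩ hpq
  simp only [labelMatrix_apply, ne_eq, ite_eq_right_iff, not_forall, Set.mem_ofPred_eq] at hpq
  obtain ⟨⟨rfl, h⟩, _⟩ := hpq
  exact ⟨p, by simp [h], rfl⟩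

/-- The homomorphism that maps the generator `i` to `1 + N`, where `N` is the matrix of the
places with label `i`. -/
def IsLabelling.hom {c : ℤ → Option ι} (hc : IsLabelling c) : FreeGroup ι →* UniTri :=
  FreeGroup.lift fun i => unipotent (labelMatrix c i) (hc.labelMatrix_mul_self i)
    (hc.labelMatrix_finite i) (Multiplicative.ofAdd 1)

theorem IsLabelling.hom_of_zpow {c : ℤ → Option ι} (hc : IsLabelling c) (i : ι) (k : ℤ) :
    (hc.hom (FreeGroup.of i ^ k)).1.val = 1 + k • labelMatrix c i := by
  rw [map_zpow, IsLabelling.hom, FreeGroup.lift_apply_of, ← map_zpow, unipotent_val, ← ofAdd_zsmul]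
  simp

/-- Each factor `1 + k N` moves at most one step off the diagonal. To get `l.length` steps away, `k
N` must be taken from every factor, and along matching labels this yields the product of the
exponents. -/
theorem IsLabelling.hom_prod_apply {c : ℤ → Option ι} (hc : IsLabelling c) (l : List (ι × ℤ)) :
    (∀ p q : ℤ, p + l.length < q →
      (hc.hom (l.map fun x => FreeGroup.of x.1 ^ x.2).prod).1.val p q = 0) ∧
    ∀ o : ℤ, (∀ k : ℕ, k < l.length → c (o + k) = (l.map Prod.fst)[k]?) →
      (hc.hom (l.map fun x => FreeGroup.of x.1 ^ x.2).prod).1.val o (o + l.length) =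
        (l.map Prod.snd).prod := by
  induction l with
  | nil =>
    refine ⟨fun p q hpq => ?_, fun o _ => ?_⟩
    · have : p ≠ q := by simp at hpq; omega
      simp [this]
    · simp
  | cons x l ih =>
    obtain ⟨ih1, ih2⟩ := ih
    have key : ∀ p q, (hc.hom ((x :: l).map fun x => FreeGroup.of x.1 ^ x.2).prod).1.val p q =
        (hc.hom (l.map fun x => FreeGroup.of x.1 ^ x.2).prod).1.val p q +
          x.2 * (labelMatrix c x.1 *
            (hc.hom (l.map fun x => FreeGroup.of x.1 ^ x.2).prod).1.val) p q := fun p q => by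
      rw [List.map_cons, List.prod_cons, map_mul, Subgroup.coe_mul, Units.val_mul, hc.hom_of_zpow,
        add_mul, one_mul, smul_mul_assoc, IncidenceAlgebra.add_apply,
        IncidenceAlgebra.constSMul_apply, smul_eq_mul]
    refine ⟨fun p q hpq => ?_, fun o ho => ?_⟩
    · rw [List.length_cons] at hpq
      push_cast at hpq
      rw [key, labelMatrix_mul_apply, ih1 p q (by omega), ih1 (p + 1) q (by omega)]
      simp
    · have h0 : c o = some x.1 := by simpa using ho 0 (by simp)
      have h1 := ih2 (o + 1) fun k hk => by
        have := ho (k + 1) (by simpa using hk)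
        rw [List.map_cons, List.getElem?_cons_succ] at this
        rw [← this]
        congr 1
        push_cast
        ring
      rw [List.length_cons, key, labelMatrix_mul_apply, if_pos h0, ih1 _ _ (by push_cast; omega),
        zero_add, List.map_cons, List.prod_cons, ← h1,
        show o + ((l.length + 1 : ℕ) : ℤ) = o + 1 + l.length by push_cast; ring]

/-- There is a labelling that contains each of finitely many given sequences of labels. -/
theorem exists_isLabelling (Ls : List (List ι)) (hL : ∀ L ∈ Ls, L.IsChain (· ≠ ·)) :
    ∃ c : ℤ → Option ι, IsLabelling c ∧
      ∀ L ∈ Ls, ∃ o : ℤ, ∀ k : ℕ, k < L.length → c (o + k) = L[k]? := by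
  suffices H : ∃ (c : ℤ → Option ι) (B : ℤ), (∀ p, c p ≠ none → 0 ≤ p ∧ p < B) ∧ 0 ≤ B ∧
      (∀ p i, c p = some i → c (p + 1) ≠ some i) ∧
      ∀ L ∈ Ls, ∃ o : ℤ, o + L.length ≤ B ∧ ∀ k : ℕ, k < L.length → c (o + k) = L[k]? by
    obtain ⟨c, B, h1, _, h2, h3⟩ := H
    refine ⟨c, ⟨(Set.finite_Ico 0 B).subset fun p hp => h1 p hp, h2⟩, fun L hL => ?_⟩
    obtain ⟨o, _, ho⟩ := h3 L hL
    exact ⟨o, ho⟩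
  induction Ls with
  | nil => exact ⟨fun _ => none, 0, by simp⟩
  | cons L Ls ih =>
    obtain ⟨c, B, h1, hB, h2, h3⟩ := ih fun L' h => hL L' (List.mem_cons_of_mem _ h)
    have hchain := List.isChain_iff_getElem.1 (hL L List.mem_cons_self)
    -- The place `B` stays unlabelled and separates the new sequence from the old ones, so no equal
    -- labels meet at the seam.
    refine ⟨fun p => if p ≤ B then c p else L[(p - (B + 1)).toNat]?, B + 1 + L.length,
      fun p hp => ?_, by omega, fun p i hp => ?_, fun L' hL' => ?_⟩
    · dsimp only at hp
      split_ifs at hp with h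
      · have := h1 p hp
        omega
      · rw [ne_eq, List.getElem?_eq_none_iff] at hp
        omega
    · dsimp only at hp ⊢
      split_ifs at hp with h
      · have := h1 p (by simp [hp])
        rw [if_pos (by omega)]
        exact h2 p i hp
      · rw [if_neg (by omega), show (p + 1 - (B + 1)).toNat = (p - (B + 1)).toNat + 1 by omega]
        intro h'
        obtain ⟨hk, hk'⟩ := List.getElem?_eq_some_iff.1 h'
        obtain ⟨hl, hl'⟩ := List.getElem?_eq_some_iff.1 hp
        exact hchain _ hk (hl'.trans hk'.symm)
    · rcases List.mem_cons.1 hL' with rfl | hL'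
      · refine ⟨B + 1, le_rfl, fun k _ => ?_⟩
        dsimp only
        rw [if_neg (by omega)]
        congr 1
        omega
      · obtain ⟨o, ho1, ho2⟩ := h3 L' hL'
        refine ⟨o, by omega, fun k hk => ?_⟩
        dsimp only
        rw [if_pos (by omega), ho2 k hk]

/-- Finitely many non-trivial elements of a free group have non-trivial images under a common
homomorphism to `M_∞`. -/
theorem exists_hom_ne_one (s : List (FreeGroup ι)) (hs : ∀ g ∈ s, g ≠ 1) :
    ∃ f : FreeGroup ι →* UniTri, ∀ g ∈ s, f g ≠ 1 := by
  have hsyl : ∀ g : FreeGroup ι, ∃ l : List (ι × ℤ), g ≠ 1 → l ≠ [] ∧ (∀ x ∈ l, x.2 ≠ 0) ∧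
      (l.map Prod.fst).IsChain (· ≠ ·) ∧ g = (l.map fun x => FreeGroup.of x.1 ^ x.2).prod :=
    fun g => by
      by_cases hg : g = 1
      · exact ⟨[], fun h => absurd hg h⟩
      · obtain ⟨l, hl⟩ := FreeGroup.exists_syllables hg
        exact ⟨l, fun _ => hl⟩
  choose l hl using hsyl
  obtain ⟨c, hc, hcl⟩ := exists_isLabelling (s.map fun g => (l g).map Prod.fst) (by
    simp only [List.mem_map, forall_exists_index, and_imp, forall_apply_eq_imp_iff₂]
    exact fun g hg => (hl g (hs g hg)).2.2.1)
  refine ⟨hc.hom, fun g hg h1 => ?_⟩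
  obtain ⟨hne, h0, -, heq⟩ := hl g (hs g hg)
  obtain ⟨o, ho⟩ := hcl _ (List.mem_map_of_mem hg)
  rw [List.length_map] at ho
  have := (hc.hom_prod_apply (l g)).2 o ho
  rw [← heq, h1] at this
  have hlen : 0 < (l g).length := List.length_pos_of_ne_nil hne
  have hone : (1 : UniTri).1.val o (o + (l g).length) = 0 := by
    change (if _ then _ else _) = _
    rw [if_neg (by omega)]
  rw [hone, eq_comm, List.prod_eq_zero_iff, List.mem_map] at this
  obtain ⟨x, hx, hx0⟩ := this
  exact h0 x hx hx0

end UniTri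

/-! ### Residual finiteness and the Hopf property of free groups -/

/-- Restriction of a matrix to the block `[a, b]²`, with entries reduced modulo `p`. -/
def UpperTriangular.restrict (a b : ℤ) (p : ℕ) :
    UpperTriangular →* Matrix (Finset.Icc a b) (Finset.Icc a b) (ZMod p) where
  toFun A := Matrix.of fun i j => (A i j : ZMod p)
  map_one' := by
    ext i j
    rw [Matrix.of_apply, IncidenceAlgebra.one_apply, Matrix.one_apply]
    simp only [Subtype.ext_iff]
    split_ifs
    · exact Int.cast_one
    · exact Int.cast_zero
  map_mul' A B := by
    ext i j
    rw [Matrix.mul_apply, Matrix.of_apply, IncidenceAlgebra.mul_apply]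
    simp only [Matrix.of_apply]
    push_cast
    rw [Finset.sum_coe_sort (Finset.Icc a b) fun x => (A i x : ZMod p) * (B x j : ZMod p)]
    have hi := Finset.mem_Icc.1 i.2
    have hj := Finset.mem_Icc.1 j.2
    -- By triangularity indices outside `[i, j]` contribute nothing to the product over the block.
    refine Finset.sum_subset (Finset.Icc_subset_Icc hi.1 hj.2) fun x _ hx => ?_
    by_cases hix : (i : ℤ) ≤ x
    · have hxj : ¬ x ≤ j := fun h => hx (Finset.mem_Icc.2 ⟨hix, h⟩)
      rw [IncidenceAlgebra.apply_eq_zero_of_not_le hxj, Int.cast_zero, mul_zero]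
    · rw [IncidenceAlgebra.apply_eq_zero_of_not_le hix, Int.cast_zero, zero_mul]

namespace FreeGroup

/-- Free groups are residually finite. -/
theorem exists_finite_hom_ne_one {ι : Type*} {g : FreeGroup ι} (hg : g ≠ 1) :
    ∃ (Q : Type) (_ : Group Q) (_ : Finite Q) (f : FreeGroup ι →* Q), f g ≠ 1 := by
  obtain ⟨f, hf⟩ := UniTri.exists_hom_ne_one [g] (by simpa using hg)
  have hfg : f g ≠ 1 := hf g (by simp)
  obtain ⟨a, b, hab, h0⟩ : ∃ a b : ℤ, a < b ∧ (f g).1.val a b ≠ 0 := by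
    by_contra! h
    refine hfg (UniTri.ext_apply fun i j hij => ?_)
    rcases hij.eq_or_lt with rfl | hij
    · rw [(f g).2.1, (1 : UniTri).2.1]
    · rw [h i j hij]
      change _ = if _ then _ else _
      rw [if_neg hij.ne]
  -- A prime exceeding the absolute value of the non-zero entry does not divide it.
  obtain ⟨p, hp, hpp⟩ := Nat.exists_infinite_primes ((f g).1.val a b).natAbs.succ
  have : Fact p.Prime := ⟨hpp⟩
  let r := ((UpperTriangular.restrict a b p).comp
    ((Units.coeHom UpperTriangular).comp UniTri.subtype)).toHomUnits
  refine ⟨_, inferInstance, inferInstance, r.comp f, fun h => ?_⟩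
  have h1 := congrArg (fun u => u.val ⟨a, Finset.mem_Icc.2 ⟨le_rfl, hab.le⟩⟩
    ⟨b, Finset.mem_Icc.2 ⟨hab.le, le_rfl⟩⟩) h
  have h2 : (((f g).1.val a b : ℤ) : ZMod p) = 0 := by
    refine Eq.trans h1 ?_
    rw [Units.val_one, Matrix.one_apply_ne]
    simp [Subtype.ext_iff, hab.ne]
  rw [ZMod.intCast_zmod_eq_zero_iff_dvd, Int.natCast_dvd] at h2
  exact absurd (Nat.le_of_dvd (Int.natAbs_pos.2 h0) h2) (by omega)

theorem finite_hom (ι : Type*) [Finite ι] (Q : Type*) [Group Q] [Finite Q] :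
    Finite (FreeGroup ι →* Q) :=
  Finite.of_equiv _ (FreeGroup.lift (α := ι) (β := Q))

/-- Finitely generated free groups are Hopfian. -/
theorem injective_of_surjective {ι : Type*} [Finite ι] (f : FreeGroup ι →* FreeGroup ι)
    (hf : Function.Surjective f) : Function.Injective f := by
  rw [injective_iff_map_eq_one]
  intro g hg
  by_contra h1
  obtain ⟨Q, _, _, h, hQ⟩ := exists_finite_hom_ne_one h1
  have := finite_hom ι Q
  -- Precomposition with `f` is an injective self-map of a finite set, hence onto. So `h` factors
  -- through `f` and kills `g`.
  have hinj : Function.Injective fun k : FreeGroup ι →* Q => k.comp f :=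
    fun k k' hk => (MonoidHom.cancel_right hf).1 hk
  obtain ⟨k, rfl⟩ := Finite.surjective_of_injective hinj h
  exact hQ (by rw [MonoidHom.comp_apply, hg]; exact _root_.map_one k)

/-- A surjection of free groups does not increase the rank. -/
theorem card_le_of_surjective {ι κ : Type*} [Finite ι]
    (f : FreeGroup ι →* FreeGroup κ) (hf : Function.Surjective f) :
    Finite κ ∧ Nat.card κ ≤ Nat.card ι := by
  classical
  -- Ranks are compared by counting homomorphisms to `ℤ/2`; there are `2 ^ rank` of them.
  have := finite_hom ι (Multiplicative (ZMod 2))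
  have hinj : Function.Injective fun g : FreeGroup κ →* Multiplicative (ZMod 2) => g.comp f :=
    fun g g' h => (MonoidHom.cancel_right hf).1 h
  have hfin := Finite.of_injective _ hinj
  have : Finite (κ → Multiplicative (ZMod 2)) := Finite.of_equiv _ FreeGroup.lift.symm
  have hκ : Finite κ := by
    refine Finite.of_injective
      (fun k : κ => (Pi.mulSingle k (Multiplicative.ofAdd 1) : κ → Multiplicative (ZMod 2))) ?_
    intro k l h
    by_contra hkl
    have := congrFun h k
    dsimp only at this
    rw [Pi.mulSingle_eq_same, Pi.mulSingle_eq_of_ne hkl] at this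
    exact absurd this (by decide)
  refine ⟨hκ, ?_⟩
  have h := Nat.card_le_card_of_injective _ hinj
  rw [← Nat.card_congr FreeGroup.lift, ← Nat.card_congr FreeGroup.lift, Nat.card_fun, Nat.card_fun,
    Nat.card_congr Multiplicative.toAdd, Nat.card_zmod] at h
  exact (Nat.pow_le_pow_iff_right one_lt_two).1 h

theorem injective_of_surjective_of_card_le {ι κ : Type*} [Finite ι]
    (f : FreeGroup ι →* FreeGroup κ) (hf : Function.Surjective f)
    (hcard : Nat.card ι ≤ Nat.card κ) : Function.Injective f := by
  obtain ⟨_, hle⟩ := card_le_of_surjective f hf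
  let e := freeGroupCongr ((Finite.card_eq.1 (hle.antisymm hcard)).some)
  have := injective_of_surjective (e.toMonoidHom.comp f) (e.surjective.comp hf)
  exact Function.Injective.of_comp this

/-- Replacing the first generator by an element outside of the subgroup generated by the other
generators defines an injective endomorphism. -/
theorem injective_lift_update {n : ℕ} {w : FreeGroup (Fin (n + 1))}
    (hw : w ∉ (FreeGroup.map (Fin.succ : Fin n → Fin (n + 1))).range) :
    Function.Injective (FreeGroup.lift (Function.update FreeGroup.of 0 w)) := by
  set θ : FreeGroup (Fin (n + 1)) →* FreeGroup (Fin (n + 1)) :=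
    FreeGroup.lift (Function.update FreeGroup.of 0 w) with hθ
  let σ := FreeGroup.map (Fin.succ : Fin n → Fin (n + 1))
  let ρ : FreeGroup (Fin (n + 1)) →* FreeGroup (Fin n) := FreeGroup.lift (Fin.cases 1 FreeGroup.of)
  have hρσ : ∀ y, ρ (σ y) = y := DFunLike.congr_fun (f := ρ.comp σ) (g := MonoidHom.id _) (by
    ext i; simp [ρ, σ])
  have hθσ : ∀ y, θ (σ y) = σ y := DFunLike.congr_fun (f := θ.comp σ) (g := σ) (by
    ext i; simp [θ, σ])
  -- The image of `θ` is free by Nielsen–Schreier. If its rank is at least `n + 1`, the Hopf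
  -- property applies to `θ`.
  let e := IsFreeGroup.toFreeGroup θ.range
  have hsurj : Function.Surjective (e.toMonoidHom.comp θ.rangeRestrict) :=
    e.surjective.comp θ.rangeRestrict_surjective
  by_cases hcard : Nat.card (Fin (n + 1)) ≤ Nat.card (IsFreeGroup.Generators θ.range)
  · have h1 := injective_of_surjective_of_card_le _ hsurj hcard
    have h2 : Function.Injective θ.rangeRestrict := Function.Injective.of_comp h1
    rwa [MonoidHom.rangeRestrict_injective_iff] at h2
  -- If the rank is at most `n`, then `ρ`, which kills the first letter, maps the image onto a free
  -- group of rank `n`, and is injective there by the Hopf property. As `w` and `σ (ρ w)` have the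
  -- same image under `ρ`, they coincide.
  · exfalso
    obtain ⟨_, -⟩ := card_le_of_surjective _ hsurj
    have hinj : Function.Injective ((ρ.comp θ.range.subtype).comp e.symm.toMonoidHom) := by
      refine injective_of_surjective_of_card_le _ (fun y => ⟨e ⟨σ y, σ y, hθσ y⟩, ?_⟩) ?_
      · simp [hρσ]
      · rw [Nat.card_fin] at hcard ⊢
        omega
    have hinj' : Function.Injective (ρ.comp θ.range.subtype) := by
      refine Function.Injective.of_comp_right hinj e.symm.surjective
    have hwmem : w ∈ θ.range := ⟨FreeGroup.of 0, by simp [θ]⟩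
    have := @hinj' ⟨w, hwmem⟩ ⟨σ (ρ w), σ (ρ w), hθσ _⟩ (by simp [hρσ])
    exact hw ⟨ρ w, (congrArg Subtype.val this).symm⟩

end FreeGroup

/-! ### Iterations of words -/

section Iteration

variable {n : ℕ} {G H : Type*} [Group G] [Group H]

theorem map_wordEval (f : G →* H) (w : FreeGroup (Fin n)) (x : Fin n → G) :
    f (wordEval w x) = wordEval w (f ∘ x) := by
  refine DFunLike.congr_fun (f := f.comp (FreeGroup.lift x)) (g := FreeGroup.lift (f ∘ x)) ?_ w
  ext i
  simp

theorem map_engelIter (f : G →* H) (w : FreeGroup (Fin (n + 1))) (x : Fin (n + 1) → G) (d : ℕ) :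
    f (engelIter w x d) = engelIter w (f ∘ x) d := by
  induction d with
  | zero => rfl
  | succ d ih => rw [engelIter, engelIter, map_wordEval, ← ih, Function.comp_update]

/-- The definition adds a new `w` on the outside; here it is split off on the inside, which is where
an endomorphism acts. -/
theorem engelIter_update (w : FreeGroup (Fin (n + 1))) (x : Fin (n + 1) → G) (d : ℕ) :
    engelIter w (Function.update x 0 (wordEval w x)) d = engelIter w x (d + 1) := by
  induction d with
  | zero => simp [engelIter]
  | succ d ih => rw [engelIter, ih, Function.update_idem, ← engelIter]

/-- The iterations of a non-trivial word are non-trivial. -/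
theorem engelIter_of_ne_one {w : FreeGroup (Fin (n + 1))} (hw : w ≠ 1) {d : ℕ} (hd : 1 ≤ d) :
    engelIter w FreeGroup.of d ≠ 1 := by
  have hlift : wordEval w FreeGroup.of = w := FreeGroup.lift_of_apply w
  by_cases hr : w ∈ (FreeGroup.map (Fin.succ : Fin n → Fin (n + 1))).range
  · obtain ⟨d, rfl⟩ := Nat.exists_eq_add_of_le' hd
    obtain ⟨v, rfl⟩ := hr
    refine ne_of_eq_of_ne (Eq.trans ?_ hlift) hw
    rw [engelIter, wordEval, wordEval]
    refine DFunLike.congr_fun (f := (FreeGroup.lift _).comp (FreeGroup.map Fin.succ))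
      (g := (FreeGroup.lift _).comp (FreeGroup.map Fin.succ)) ?_ v
    ext i
    simp
  -- Here the iterate is the image of the first letter under the `d`-th power of an injective
  -- endomorphism.
  · have hθ := FreeGroup.injective_lift_update hr
    clear hd
    induction d with
    | zero => exact FreeGroup.of_ne_one 0
    | succ d ih =>
      rw [← engelIter_update, hlift]
      have := map_engelIter (FreeGroup.lift (Function.update FreeGroup.of 0 w)) w FreeGroup.of d
      rw [show (FreeGroup.lift (Function.update FreeGroup.of 0 w)) ∘ FreeGroup.of =
        Function.update FreeGroup.of 0 w from funext fun i => FreeGroup.lift_apply_of] at this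
      rw [← this]
      exact fun h => ih (hθ (h.trans (map_one _).symm))

theorem not_satisfiesIdentity_of_injective (f : UniTri →* G) (hf : Function.Injective f)
    {w : FreeGroup (Fin n)} (hw : w ≠ 1) : ¬ SatisfiesIdentity w G := fun h => by
  obtain ⟨g, hg⟩ := UniTri.exists_hom_ne_one [w] (by simpa using hw)
  have hlift : wordEval w FreeGroup.of = w := FreeGroup.lift_of_apply w
  have := h ((f.comp g) ∘ FreeGroup.of)
  rw [← map_wordEval, hlift, MonoidHom.comp_apply, map_eq_one_iff f hf] at this
  exact hg w (by simp) this

theorem iterDepth_eq_top_of_injective (f : UniTri →* G) (hf : Function.Injective f)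
    {w : FreeGroup (Fin (n + 1))} (hw : w ≠ 1) : iterDepth w G = ⊤ := by
  rw [iterDepth, sInf_eq_top]
  rintro _ ⟨D, rfl, hD⟩
  exfalso
  obtain ⟨g, hg⟩ := UniTri.exists_hom_ne_one
    ((List.range D).map fun d => engelIter w FreeGroup.of (d + 1)) (by
      simp only [List.mem_map, forall_exists_index, and_imp, forall_apply_eq_imp_iff₂]
      exact fun d _ => engelIter_of_ne_one hw (Nat.le_add_left 1 d))
  obtain ⟨d, hd1, hdD, h⟩ := hD ((f.comp g) ∘ FreeGroup.of)
  rw [← map_engelIter, MonoidHom.comp_apply, map_eq_one_iff f hf] at h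
  refine hg _ (List.mem_map.2 ⟨d - 1, List.mem_range.2 (by omega), rfl⟩) ?_
  rwa [Nat.sub_add_cancel hd1]

theorem isFractalWrtIdentities_of_iterDepth_eq_top {w : FreeGroup (Fin (n + 1))} (hw : w ≠ 1)
    (hG : SatisfiesIteratedIdentity w G) (hd : iterDepth w G = ⊤) : IsFractalWrtIdentities G :=
  le_antisymm le_top (le_sSup ⟨n, w, hw, hG, by rw [hd]⟩)

end Iteration

/-! ### Elementary amenable groups -/

namespace IsElementaryAmenable

theorem of_hom {G H : Type} [Group G] [Group H] (f : G →* H) (hH : IsElementaryAmenable H)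
    (hker : IsElementaryAmenable f.ker) : IsElementaryAmenable G :=
  extension G f.ker hker
    (of_mulEquiv f.range _ (QuotientGroup.quotientKerEquivRange f).symm (subgroup H f.range hH))

theorem of_injective {G H : Type} [Group G] [Group H] (f : G →* H) (hf : Function.Injective f)
    (hH : IsElementaryAmenable H) : IsElementaryAmenable G :=
  of_mulEquiv f.range G (MonoidHom.ofInjective hf).symm (subgroup H f.range hH)

theorem prod {G H : Type} [Group G] [Group H] (hG : IsElementaryAmenable G)
    (hH : IsElementaryAmenable H) : IsElementaryAmenable (G × H) := by
  refine of_hom (MonoidHom.fst G H) hG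
    (of_injective ((MonoidHom.snd G H).comp (MonoidHom.fst G H).ker.subtype) ?_ hH)
  rintro ⟨x, hx⟩ ⟨y, hy⟩ h
  exact Subtype.ext (Prod.ext ((MonoidHom.mem_ker.1 hx).trans (MonoidHom.mem_ker.1 hy).symm) h)

theorem semidirectProduct {N Q : Type} [Group N] [Group Q] (φ : Q →* MulAut N)
    (hN : IsElementaryAmenable N) (hQ : IsElementaryAmenable Q) :
    IsElementaryAmenable (N ⋊[φ] Q) := by
  refine of_hom SemidirectProduct.rightHom hQ ?_
  rw [← SemidirectProduct.range_inl_eq_ker_rightHom]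
  exact of_mulEquiv N _ (MonoidHom.ofInjective SemidirectProduct.inl_injective) hN

/-- The derived series is climbed from its trivial term, each step being an extension with abelian
quotient. -/
theorem of_isSolvable (G : Type) [Group G] [Group.IsSolvable G] : IsElementaryAmenable G := by
  obtain ⟨n, hn⟩ := Group.IsSolvable.solvable (G := G)
  have hstep : ∀ k ≤ n, IsElementaryAmenable (derivedSeries G (n - k)) := by
    intro k
    induction k with
    | zero =>
      intro _
      rw [Nat.sub_zero, hn]
      exact of_finite _
    | succ k ih =>
      intro hk
      have hle : derivedSeries G (n - k) ≤ derivedSeries G (n - (k + 1)) :=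
        derivedSeries_antitone G (by omega)
      refine extension _ ((derivedSeries G (n - k)).subgroupOf (derivedSeries G (n - (k + 1))))
        (of_mulEquiv _ _ (Subgroup.subgroupOfEquivOfLe hle).symm (ih (by omega))) (of_comm _ ?_)
      rintro ⟨a⟩ ⟨b⟩
      refine QuotientGroup.eq.2 ?_
      have hmem : ⁅b⁻¹.1, a⁻¹.1⁆ ∈ derivedSeries G (n - k) := by
        rw [show n - k = n - (k + 1) + 1 by omega]
        exact Subgroup.commutator_mem_commutator (b⁻¹).2 (a⁻¹).2
      rw [Subgroup.mem_subgroupOf]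
      convert hmem using 1
      rw [commutatorElement_def]
      simp [mul_assoc]
  have := hstep n le_rfl
  rw [Nat.sub_self, derivedSeries_zero] at this
  exact of_mulEquiv _ _ Subgroup.topEquiv this

theorem uniTri : IsElementaryAmenable UniTri := by
  refine directedUnion _ (Set.range UniTri.block) ⟨_, 0, rfl⟩ ?_ ?_ ?_
  · rintro _ ⟨m, rfl⟩ _ ⟨n, rfl⟩
    exact ⟨_, ⟨max m n, rfl⟩, UniTri.block_mono (le_max_left m n),
      UniTri.block_mono (le_max_right m n)⟩
  · rintro _ ⟨n, rfl⟩
    exact of_isSolvable _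
  · intro u
    obtain ⟨n, hn⟩ := UniTri.exists_mem_block u
    exact ⟨_, ⟨n, rfl⟩, hn⟩

theorem shiftExtension : IsElementaryAmenable ShiftExtension :=
  semidirectProduct _ uniTri (of_comm _ mul_comm)

end IsElementaryAmenable

/-! ### The iterated identities `[x₁, [x₂, x₃]]` -/

/-- All commutators lie in a normal subgroup any two elements of which lie in a common nilpotent
subgroup. -/
def IsLocallyNilpotentByAbelian (G : Type*) [Group G] : Prop :=
  ∃ N : Subgroup G, N.Normal ∧ (∀ a b : G, ⁅a, b⁆ ∈ N) ∧
    ∀ a ∈ N, ∀ b ∈ N, ∃ B : Subgroup G, Group.IsNilpotent B ∧ a ∈ B ∧ b ∈ B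

theorem IsLocallyNilpotentByAbelian.prod {G H : Type*} [Group G] [Group H]
    (hG : IsLocallyNilpotentByAbelian G) (hH : IsLocallyNilpotentByAbelian H) :
    IsLocallyNilpotentByAbelian (G × H) := by
  obtain ⟨N, _, hN, hNB⟩ := hG
  obtain ⟨M, _, hM, hMB⟩ := hH
  refine ⟨N.prod M, inferInstance, fun a b => ⟨hN _ _, hM _ _⟩, fun a ha b hb => ?_⟩
  obtain ⟨B, _, ha1, hb1⟩ := hNB _ ha.1 _ hb.1
  obtain ⟨C, _, ha2, hb2⟩ := hMB _ ha.2 _ hb.2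
  exact ⟨B.prod C, (Group.isNilpotent_congr (B.prodEquiv C)).2 inferInstance, ⟨ha1, ha2⟩, hb1, hb2⟩

theorem IsLocallyNilpotentByAbelian.semidirectProduct {N Q : Type*} [Group N] [CommGroup Q]
    (φ : Q →* MulAut N)
    (hN : ∀ a b : N, ∃ B : Subgroup N, Group.IsNilpotent B ∧ a ∈ B ∧ b ∈ B) :
    IsLocallyNilpotentByAbelian (N ⋊[φ] Q) := by
  refine ⟨SemidirectProduct.rightHom.ker, inferInstance, fun a b => ?_, ?_⟩
  · rw [MonoidHom.mem_ker, map_commutatorElement, commutatorElement_eq_one_iff_mul_comm, mul_comm]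
  · rw [← SemidirectProduct.range_inl_eq_ker_rightHom]
    rintro _ ⟨a, rfl⟩ _ ⟨b, rfl⟩
    obtain ⟨B, _, ha, hb⟩ := hN a b
    exact ⟨B.map SemidirectProduct.inl, (Group.isNilpotent_congr (B.equivMapOfInjective _
      SemidirectProduct.inl_injective)).1 inferInstance, ⟨a, ha, rfl⟩, b, hb, rfl⟩

/-- Iterated commutators with an element `c` of a normal subgroup become trivial, if any two
elements of this subgroup lie in a common nilpotent subgroup. -/
theorem exists_iterate_eq_one {G : Type*} [Group G] {N : Subgroup G} [N.Normal]
    (hNB : ∀ a ∈ N, ∀ b ∈ N, ∃ B : Subgroup G, Group.IsNilpotent B ∧ a ∈ B ∧ b ∈ B)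
    {c : G} (hc : c ∈ N) (F : G → G) (hF : ∀ y, F y = ⁅y, c⁆ ∨ F y = ⁅y⁻¹, c⁆) (y : ℕ → G)
    (hy : ∀ d, y (d + 1) = F (y d)) : ∃ d, 1 ≤ d ∧ y d = 1 := by
  -- The start `y 0` is arbitrary, but one step leads into `N`, where `y 1` and `c` share a
  -- nilpotent subgroup.
  have hy1 : y 1 ∈ N := by
    have hmem : ∀ g : G, ⁅g, c⁆ ∈ N := fun g =>
      N.mul_mem (Subgroup.Normal.conj_mem ‹_› c hc g) (N.inv_mem hc)
    rw [show y 1 = F (y 0) from hy 0]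
    rcases hF (y 0) with h | h
    · exact h ▸ hmem _
    · exact h ▸ hmem _
  obtain ⟨B, _, hyB, hcB⟩ := hNB _ hy1 _ hc
  obtain ⟨m, H, ⟨h0, hs⟩, hm⟩ :=
    (Subgroup.nilpotent_iff_finite_descending_central_series (G := B)).1 inferInstance
  have key : ∀ d, ∃ z ∈ H d, (z : G) = y (d + 1) := by
    intro d
    induction d with
    | zero => exact ⟨⟨_, hyB⟩, by rw [h0]; trivial, rfl⟩
    | succ d ih =>
      obtain ⟨z, hz, hzy⟩ := ih
      rcases hF (y (d + 1)) with h | h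
      · exact ⟨⁅z, ⟨c, hcB⟩⁆, hs z d hz _, by rw [hy, h, ← hzy]; rfl⟩
      · exact ⟨⁅z⁻¹, ⟨c, hcB⟩⁆, hs _ d (inv_mem hz) _, by rw [hy, h, ← hzy]; rfl⟩
  obtain ⟨z, hz, hzy⟩ := key m
  rw [hm, Subgroup.mem_bot] at hz
  exact ⟨m + 1, by omega, by rw [← hzy, hz]; rfl⟩

theorem IsLocallyNilpotentByAbelian.commWord {G : Type*} [Group G]
    (hG : IsLocallyNilpotentByAbelian G) : SatisfiesIteratedIdentity commWord G := by
  obtain ⟨N, _, hN, hNB⟩ := hG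
  intro x
  refine exists_iterate_eq_one hNB (hN (x 1) (x 2)) (fun y => ⁅y, ⁅x 1, x 2⁆⁆)
    (fun y => Or.inl rfl) (engelIter _root_.commWord x) fun d => ?_
  rw [engelIter]
  simp [wordEval, _root_.commWord, leftComm, commutatorElement_def]

theorem IsLocallyNilpotentByAbelian.commWord' {G : Type*} [Group G]
    (hG : IsLocallyNilpotentByAbelian G) : SatisfiesIteratedIdentity commWord' G := by
  obtain ⟨N, _, hN, hNB⟩ := hG
  intro x
  -- In this convention the commutator of `a` and `b` is `⁅a⁻¹, b⁻¹⁆`, applied here to both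
  -- brackets.
  refine exists_iterate_eq_one hNB (N.inv_mem (hN (x 1)⁻¹ (x 2)⁻¹))
    (fun y => ⁅y⁻¹, ⁅(x 1)⁻¹, (x 2)⁻¹⁆⁻¹⁆)
    (fun y => Or.inr rfl) (engelIter _root_.commWord' x) fun d => ?_
  rw [engelIter]
  simp [wordEval, _root_.commWord', rightComm, commutatorElement_def, mul_assoc]

/-- In `S₃` the commutator of two distinct transpositions is a 3-cycle, which does not commute with
a transposition. -/
theorem commWord_ne_one : commWord ≠ 1 := fun h => by
  have := congrArg (FreeGroup.lift
    (![Equiv.swap 0 1, Equiv.swap 0 1, Equiv.swap 1 2] : Fin 3 → Equiv.Perm (Fin 3))) h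
  simp only [commWord, leftComm, map_mul, map_inv, FreeGroup.lift_apply_of, map_one] at this
  revert this
  decide

theorem ShiftExtension.isLocallyNilpotentByAbelian : IsLocallyNilpotentByAbelian ShiftExtension :=
  .semidirectProduct _ fun a b => by
    obtain ⟨m, hm⟩ := UniTri.exists_mem_block a
    obtain ⟨n, hn⟩ := UniTri.exists_mem_block b
    exact ⟨UniTri.block (max m n), inferInstance, UniTri.block_mono (le_max_left m n) hm,
      UniTri.block_mono (le_max_right m n) hn⟩

/-! ### Finite generation -/

/-- A semidirect product with `ℤ` is generated by the generator `1` of `ℤ` and an element `a`, if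
the group has no proper shift-invariant subgroup that contains `a`. -/
theorem fg_semidirectProduct {N : Type*} [Group N] (φ : MulAut N) (a : N)
    (h : ∀ S : Subgroup N, a ∈ S → (∀ u, u ∈ S ↔ φ u ∈ S) → S = ⊤) :
    Group.FG (N ⋊[zpowersHom (MulAut N) φ] Multiplicative ℤ) := by
  set Γ : Subgroup (N ⋊[zpowersHom (MulAut N) φ] Multiplicative ℤ) :=
    Subgroup.closure {SemidirectProduct.inl a, SemidirectProduct.inr (Multiplicative.ofAdd 1)}
  have ht : SemidirectProduct.inr (Multiplicative.ofAdd 1) ∈ Γ :=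
    Subgroup.subset_closure (by simp)
  have hN : Γ.comap SemidirectProduct.inl = ⊤ := by
    refine h _ (Subgroup.subset_closure (by simp)) fun u => ?_
    have hu := SemidirectProduct.inl_aut (φ := zpowersHom (MulAut N) φ) (Multiplicative.ofAdd 1) u
    rw [zpowersHom_apply, toAdd_ofAdd, zpow_one] at hu
    rw [Subgroup.mem_comap, Subgroup.mem_comap, hu, map_inv,
      Subgroup.mul_mem_cancel_right _ (Γ.inv_mem ht), Subgroup.mul_mem_cancel_left _ ht]
  refine Group.fg_iff.2 ⟨_, (Subgroup.eq_top_iff' _).2 fun x => ?_, Set.toFinite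
    {SemidirectProduct.inl a, SemidirectProduct.inr (Multiplicative.ofAdd 1)}⟩
  rw [← SemidirectProduct.inl_left_mul_inr_right x]
  refine Γ.mul_mem ?_ ?_
  · rw [← Subgroup.mem_comap, hN]
    trivial
  · have : x.right = Multiplicative.ofAdd 1 ^ x.right.toAdd := by
      rw [← ofAdd_zsmul]; simp
    rw [this, map_zpow]
    exact Γ.zpow_mem ht _

theorem ShiftExtension.fg : Group.FG ShiftExtension :=
  fg_semidirectProduct shiftAut (UniTri.elementary 0 1 (Multiplicative.ofAdd 1)) fun _ h0 hs =>
    UniTri.eq_top_of_shift_mem h0 hs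

/-! ### Central extensions given by a bilinear map -/

/-- The central extension of `V` by `Z` with the cocycle `β`. -/
@[ext]
structure BilinearExtension {V Z : Type*} [AddCommGroup V] [AddCommGroup Z]
    (β : V →ₗ[ℤ] V →ₗ[ℤ] Z) where
  base : V
  fiber : Z

namespace BilinearExtension

variable {V Z : Type*} [AddCommGroup V] [AddCommGroup Z] {β : V →ₗ[ℤ] V →ₗ[ℤ] Z}

instance : Mul (BilinearExtension β) :=
  ⟨fun a b => ⟨a.base + b.base, a.fiber + b.fiber + β a.base b.base⟩⟩

instance : One (BilinearExtension β) := ⟨⟨0, 0⟩⟩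

instance : Inv (BilinearExtension β) := ⟨fun a => ⟨-a.base, -a.fiber + β a.base a.base⟩⟩

@[simp] theorem mul_base (a b : BilinearExtension β) : (a * b).base = a.base + b.base := rfl

@[simp] theorem mul_fiber (a b : BilinearExtension β) :
    (a * b).fiber = a.fiber + b.fiber + β a.base b.base := rfl

@[simp] theorem one_base : (1 : BilinearExtension β).base = 0 := rfl

@[simp] theorem one_fiber : (1 : BilinearExtension β).fiber = 0 := rfl

@[simp] theorem inv_base (a : BilinearExtension β) : a⁻¹.base = -a.base := rfl

@[simp] theorem inv_fiber (a : BilinearExtension β) :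
    a⁻¹.fiber = -a.fiber + β a.base a.base := rfl

instance : Group (BilinearExtension β) :=
  Group.ofLeftAxioms
    (fun a b c => by
      ext
      · simp [add_assoc]
      · simp only [mul_fiber, mul_base, map_add, LinearMap.add_apply]
        abel)
    (fun a => by ext <;> simp)
    (fun a => by ext <;> simp)

/-- The projection to the base. -/
def baseHom (β : V →ₗ[ℤ] V →ₗ[ℤ] Z) : BilinearExtension β →* Multiplicative V where
  toFun a := Multiplicative.ofAdd a.base
  map_one' := rfl
  map_mul' _ _ := rfl

/-- The inclusion of the fiber. -/
def fiberHom (β : V →ₗ[ℤ] V →ₗ[ℤ] Z) : Multiplicative Z →* BilinearExtension β where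
  toFun z := ⟨0, z.toAdd⟩
  map_one' := rfl
  map_mul' _ _ := by ext <;> simp

theorem fiberHom_mul_comm (z : Multiplicative Z) (a : BilinearExtension β) :
    fiberHom β z * a = a * fiberHom β z := by
  ext <;> simp [fiberHom, add_comm]

theorem eq_fiberHom {a : BilinearExtension β} (h : a.base = 0) :
    a = fiberHom β (Multiplicative.ofAdd a.fiber) := by
  ext <;> simp [fiberHom, h]

instance : Group.IsNilpotent (BilinearExtension β) :=
  Subgroup.isNilpotent_of_ker_le_center (baseHom β) (fun a ha => by
    rw [eq_fiberHom (a := a) ha, Subgroup.mem_center_iff]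
    exact fun g => (fiberHom_mul_comm _ g).symm)

/-- Only the antisymmetrisation of `β` matters. A form vanishing on `(eᵢ, eⱼ)` for `i > j` thus has
its values for `i < j` as commutators. -/
theorem commutator_eq (a b : BilinearExtension β) :
    ⁅a, b⁆ = fiberHom β (Multiplicative.ofAdd (β a.base b.base - β b.base a.base)) := by
  rw [commutatorElement_def, mul_inv_eq_iff_eq_mul, mul_inv_eq_iff_eq_mul, mul_assoc]
  ext
  · simp [fiberHom, add_comm]
  · simp only [mul_fiber, mul_base, fiberHom, MonoidHom.coe_mk, OneHom.coe_mk, toAdd_ofAdd,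
      map_zero, LinearMap.zero_apply]
    abel

/-- The automorphism given by an isometry of the bilinear map. -/
def congrBase (σ : V ≃ₗ[ℤ] V) (hσ : ∀ v w, β (σ v) (σ w) = β v w) : MulAut (BilinearExtension β) where
  toFun a := ⟨σ a.base, a.fiber⟩
  invFun a := ⟨σ.symm a.base, a.fiber⟩
  left_inv a := by ext <;> simp
  right_inv a := by ext <;> simp
  map_mul' a b := by ext <;> simp [hσ]

end BilinearExtension

/-! ### Extensions of a sequence of relations by the shift -/

section ShiftForm

variable {Z : Type*} [AddCommGroup Z] (z : ℕ → Z)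

/-- The shift-invariant bilinear form with `β(eᵢ, eⱼ) = z (j - i)` for `i ≤ j` and `0` otherwise. -/
def shiftForm : (ℤ →₀ ℤ) →ₗ[ℤ] (ℤ →₀ ℤ) →ₗ[ℤ] Z :=
  Finsupp.linearCombination ℤ fun i => Finsupp.linearCombination ℤ fun j =>
    if i ≤ j then z (j - i).toNat else 0

theorem shiftForm_single (i j : ℤ) :
    shiftForm z (Finsupp.single i 1) (Finsupp.single j 1) = if i ≤ j then z (j - i).toNat else 0 := by
  simp [shiftForm]

/-- The shift of `⨁ ℤ`. -/
def finsuppShift : (ℤ →₀ ℤ) ≃ₗ[ℤ] (ℤ →₀ ℤ) := Finsupp.domLCongr (Equiv.addRight 1)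

theorem finsuppShift_single (i a : ℤ) :
    finsuppShift (Finsupp.single i a) = Finsupp.single (i + 1) a := by
  simp [finsuppShift]

theorem finsuppShift_apply (v : ℤ →₀ ℤ) (i : ℤ) : finsuppShift v (i + 1) = v i := by
  simp [finsuppShift, Finsupp.domLCongr_apply, Finsupp.domCongr_apply, Finsupp.equivMapDomain_apply]

theorem shiftForm_shift (v w : ℤ →₀ ℤ) :
    shiftForm z (finsuppShift v) (finsuppShift w) = shiftForm z v w := by
  have : ((shiftForm z).compl₁₂ finsuppShift.toLinearMap finsuppShift.toLinearMap) =
      shiftForm z := by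
    ext i j
    simp [finsuppShift_single, shiftForm_single]
  exact LinearMap.congr_fun₂ this v w

/-- The automorphism of the central extension that is induced by the shift. -/
def formShift : MulAut (BilinearExtension (shiftForm z)) :=
  BilinearExtension.congrBase finsuppShift (shiftForm_shift z)

theorem formShift_base (a : BilinearExtension (shiftForm z)) :
    (formShift z a).base = finsuppShift a.base := rfl

/-- A finitely generated group with the center `Z`, where `Z` is generated by `z 1, z 2, …`. -/
abbrev HallGroup : Type _ :=
  BilinearExtension (shiftForm z) ⋊[zpowersHom (MulAut (BilinearExtension (shiftForm z)))
    (formShift z)] Multiplicative ℤ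

/-- The shifts of `e₀` generate the base, and `[e₀, e_{n+1}] = z (n + 1)` gives the fiber. The value
`z 0` is no such commutator, hence the index `n + 1`. -/
theorem HallGroup.fg (hz : AddSubgroup.closure (Set.range fun n => z (n + 1)) = ⊤) :
    Group.FG (HallGroup z) := by
  refine fg_semidirectProduct (formShift z) ⟨Finsupp.single 0 1, 0⟩ fun S h0 hS => ?_
  have hshift : ∀ i, formShift z ⟨Finsupp.single i 1, 0⟩ = ⟨Finsupp.single (i + 1) 1, 0⟩ :=
    fun i => by
      ext1
      · exact finsuppShift_single i 1
      · rfl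
  have h1 : ∀ i : ℤ, ⟨Finsupp.single i 1, 0⟩ ∈ S := fun i => by
    induction i using Int.induction_on with
    | zero => exact h0
    | succ i ih => rwa [hS, hshift] at ih
    | pred i ih => rwa [hS, hshift, sub_add_cancel]
  have h2 : ∀ x : Z, BilinearExtension.fiberHom _ (Multiplicative.ofAdd x) ∈ S := fun x => by
    have hx : x ∈ AddSubgroup.closure (Set.range fun n => z (n + 1)) := hz ▸ AddSubgroup.mem_top x
    induction hx using AddSubgroup.closure_induction with
    | mem x hx =>
      obtain ⟨n, rfl⟩ := hx
      have hc : ⁅(⟨Finsupp.single 0 1, 0⟩ : BilinearExtension (shiftForm z)),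
          ⟨Finsupp.single (n + 1 : ℕ) 1, 0⟩⁆ ∈ S := by
        rw [commutatorElement_def]
        exact S.mul_mem (S.mul_mem (S.mul_mem (h1 _) (h1 _)) (S.inv_mem (h1 _))) (S.inv_mem (h1 _))
      rw [BilinearExtension.commutator_eq, shiftForm_single, shiftForm_single, if_pos (by omega),
        if_neg (by omega), sub_zero, sub_zero, Int.toNat_natCast] at hc
      exact hc
    | zero => rw [ofAdd_zero, map_one]; exact S.one_mem
    | add x y _ _ hx hy => rw [ofAdd_add, map_mul]; exact S.mul_mem hx hy
    | neg x _ hx => rw [ofAdd_neg, map_inv]; exact S.inv_mem hx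
  have h3 : ∀ v, Multiplicative.ofAdd v ∈ S.map (BilinearExtension.baseHom _) := fun v => by
    induction v using Finsupp.induction_linear with
    | zero => exact Subgroup.one_mem _
    | add v w hv hw => exact Subgroup.mul_mem _ hv hw
    | single i a =>
      have : Multiplicative.ofAdd (Finsupp.single i a) =
          Multiplicative.ofAdd (Finsupp.single i (1 : ℤ)) ^ a := by
        rw [← ofAdd_zsmul, Finsupp.smul_single]
        simp
      rw [this]
      exact Subgroup.zpow_mem _ (Subgroup.mem_map.2 ⟨_, h1 i, rfl⟩) _
  refine (Subgroup.eq_top_iff' _).2 fun a => ?_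
  obtain ⟨b, hb, hba⟩ := h3 a.base
  have hba : b.base = a.base := hba
  have := h2 (b⁻¹ * a).fiber
  rw [← BilinearExtension.eq_fiberHom (by simp [hba])] at this
  exact (Subgroup.mul_mem_cancel_left S (S.inv_mem hb)).1 this

theorem HallGroup.isLocallyNilpotentByAbelian : IsLocallyNilpotentByAbelian (HallGroup z) :=
  .semidirectProduct _ fun _ _ => ⟨⊤, Group.isNilpotent_top.2 inferInstance, trivial, trivial⟩

theorem HallGroup.isElementaryAmenable {Z : Type} [AddCommGroup Z] (z : ℕ → Z) :
    IsElementaryAmenable (HallGroup z) :=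
  .semidirectProduct _ (.of_isSolvable _) (.of_comm _ mul_comm)

end ShiftForm

/-! ### Torsion in the center -/

/-- The group has a central element of order `p` (if `p` is a prime number). -/
def HasCentralTorsion (G : Type*) [Group G] (p : ℕ) : Prop :=
  ∃ x : G, (∀ y, x * y = y * x) ∧ x ^ p = 1 ∧ x ≠ 1

theorem HasCentralTorsion.of_mulEquiv {G H : Type*} [Group G] [Group H] (e : G ≃* H) {p : ℕ}
    (h : HasCentralTorsion G p) : HasCentralTorsion H p := by
  obtain ⟨x, hx, hp, h1⟩ := h
  refine ⟨e x, fun y => ?_, by rw [← map_pow, hp, map_one], by simpa using h1⟩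
  obtain ⟨y, rfl⟩ := e.surjective y
  rw [← map_mul, hx, map_mul]

/-- A torsion element of a semidirect product with `ℤ` that commutes with the generator of `ℤ` is
a fixed point of the automorphism. -/
theorem exists_eq_inl_of_pow_eq_one {N : Type*} [Group N] (φ : MulAut N) {p : ℕ} (hp : p ≠ 0)
    {x : N ⋊[zpowersHom (MulAut N) φ] Multiplicative ℤ} (hx : ∀ y, x * y = y * x)
    (hxp : x ^ p = 1) : ∃ u : N, x = SemidirectProduct.inl u ∧ φ u = u ∧ u ^ p = 1 := by
  -- `ℤ` is torsion-free.
  have hr : x.right = 1 := by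
    have h := congrArg SemidirectProduct.rightHom hxp
    rw [map_pow, map_one] at h
    exact (pow_eq_one_iff.1 h).resolve_right hp
  obtain ⟨u, rfl⟩ : ∃ u : N, x = SemidirectProduct.inl u :=
    ⟨x.left, by ext <;> simp [hr]⟩
  refine ⟨u, rfl, ?_, ?_⟩
  · have h := congrArg SemidirectProduct.left (hx (SemidirectProduct.inr (Multiplicative.ofAdd 1)))
    simpa using h.symm
  · rw [← map_pow, ← map_one SemidirectProduct.inl] at hxp
    exact SemidirectProduct.inl_injective hxp

/-- The shift has no non-zero finitely supported fixed point. -/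
theorem eq_zero_of_shift_invariant {f : ℤ → ℤ} (hf : f.support.Finite)
    (h : ∀ i, f (i + 1) = f i) (i : ℤ) : f i = 0 := by
  by_contra hi
  have hconst : ∀ j, f j = f 0 := fun j => by
    induction j using Int.induction_on with
    | zero => rfl
    | succ j ih => rw [h, ih]
    | pred j ih => rw [← h, sub_add_cancel, ih]
  refine Set.infinite_univ (α := ℤ) (hf.subset fun j _ => ?_)
  rw [Function.mem_support, hconst, ← hconst i]
  exact hi

/-- Each superdiagonal is a finitely supported, shift-invariant function on `ℤ`. -/
theorem UniTri.eq_one_of_shiftAut_eq {u : UniTri} (h : shiftAut u = u) : u = 1 := by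
  have hs : ∀ i j : ℤ, u.1.val (i + 1) (j + 1) = u.1.val i j := fun i j => by
    conv_lhs => rw [← h]
    change translateDiag 1 u.1.val (i + 1) (j + 1) = _
    rw [translateDiag_apply, add_sub_cancel_right, add_sub_cancel_right]
  refine UniTri.ext_apply fun i j hij => ?_
  rcases hij.eq_or_lt with rfl | hij
  · rw [u.2.1, (1 : UniTri).2.1]
  · change _ = if _ then _ else _
    rw [if_neg hij.ne]
    have := eq_zero_of_shift_invariant (f := fun k => u.1.val k (k + (j - i)))
      ((u.2.2.image Prod.fst).subset fun k hk =>
        ⟨(k, k + (j - i)), ⟨by simp; omega, hk⟩, rfl⟩)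
      (fun k => by rw [← hs k, add_right_comm]) i
    simpa using this

/-- Central torsion is fixed by both shifts, so its components in `M_∞` and in the base are trivial
and only the fiber remains. Conversely the fiber is central and fixed by the shift. -/
theorem hasCentralTorsion_prod_hallGroup_iff {Z : Type*} [AddCommGroup Z] (z : ℕ → Z) {p : ℕ}
    (hp : p ≠ 0) :
    HasCentralTorsion (ShiftExtension × HallGroup z) p ↔ ∃ x : Z, p • x = 0 ∧ x ≠ 0 := by
  constructor
  · rintro ⟨⟨g, k⟩, hc, hxp, h1⟩
    obtain ⟨u, rfl, hu, -⟩ := exists_eq_inl_of_pow_eq_one shiftAut hp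
      (fun y => congrArg Prod.fst (hc (y, 1))) (congrArg Prod.fst hxp)
    obtain ⟨a, rfl, ha, hap⟩ := exists_eq_inl_of_pow_eq_one (formShift z) hp
      (fun y => congrArg Prod.snd (hc (1, y))) (congrArg Prod.snd hxp)
    have hu1 := UniTri.eq_one_of_shiftAut_eq hu
    have hb : a.base = 0 := Finsupp.ext fun i =>
      eq_zero_of_shift_invariant (f := a.base) (by simp [Finsupp.fun_support_eq, Finset.finite_toSet])
        (fun i => by
          conv_lhs => rw [← ha, formShift_base, finsuppShift_apply]) i
    have haf := BilinearExtension.eq_fiberHom hb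
    refine ⟨a.fiber, ?_, fun h0 => h1 ?_⟩
    · rw [haf, ← map_pow] at hap
      exact congrArg BilinearExtension.fiber hap
    · rw [hu1, haf, h0, ofAdd_zero, map_one, map_one, map_one]
      rfl
  · rintro ⟨x, hxp, hx⟩
    refine ⟨(1, SemidirectProduct.inl (BilinearExtension.fiberHom _ (Multiplicative.ofAdd x))), ?_,
      ?_, ?_⟩
    · rintro ⟨g, k⟩
      have hfix : ∀ m : ℤ, (formShift z ^ m) (BilinearExtension.fiberHom _ (Multiplicative.ofAdd x)) =
          BilinearExtension.fiberHom _ (Multiplicative.ofAdd x) := fun m => by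
        have hmem : formShift z ∈ MulAction.stabilizer
            (MulAut (BilinearExtension (shiftForm z)))
            (BilinearExtension.fiberHom (shiftForm z) (Multiplicative.ofAdd x)) := by
          rw [MulAction.mem_stabilizer_iff, MulAut.smul_def]
          ext1
          · exact map_zero finsuppShift
          · rfl
        exact (Subgroup.zpow_mem _ hmem m)
      refine Prod.ext (by simp) (SemidirectProduct.ext ?_ (by simp))
      simp only [Prod.mk_mul_mk, SemidirectProduct.mul_left, SemidirectProduct.left_inl,
        SemidirectProduct.right_inl, map_one, MulAut.one_apply, zpowersHom_apply, hfix]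
      exact BilinearExtension.fiberHom_mul_comm _ _
    · rw [Prod.pow_mk, one_pow, ← map_pow, ← map_pow, ← ofAdd_nsmul, hxp, ofAdd_zero, map_one,
        map_one]
      rfl
    · intro h
      have h2 : SemidirectProduct.inl _ = (1 : HallGroup z) := congrArg Prod.snd h
      rw [map_eq_one_iff _ SemidirectProduct.inl_injective] at h2
      exact hx (congrArg BilinearExtension.fiber h2)

/-! ### A direct sum of groups of prime order -/

section PrimeSum

/-- The prime numbers. -/
abbrev PrimeNumber : Type := {p : ℕ // p.Prime}

open Classical in
/-- The generator of the summand of order `n`, if `n` is in `S`; otherwise `0`. -/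
def primeGenerator (S : Set PrimeNumber) (n : ℕ) : ∀ q : PrimeNumber, ZMod q :=
  fun q => if q ∈ S ∧ (q : ℕ) = n then 1 else 0

/-- The direct sum of the groups `ℤ/p`, for `p` in `S`. -/
abbrev primeSum (S : Set PrimeNumber) : AddSubgroup (∀ q : PrimeNumber, ZMod q) :=
  AddSubgroup.closure (Set.range (primeGenerator S))

/-- The generators of the direct sum. -/
def primeSumGenerator (S : Set PrimeNumber) (n : ℕ) : primeSum S :=
  ⟨primeGenerator S n, AddSubgroup.subset_closure ⟨n, rfl⟩⟩

/-- Since `0` is not prime, the generator of index `0` vanishes and may be dropped, as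
`HallGroup.fg` requires. -/
theorem closure_primeSumGenerator (S : Set PrimeNumber) :
    AddSubgroup.closure (Set.range fun n => primeSumGenerator S (n + 1)) = ⊤ := by
  refine top_le_iff.1 ((AddSubgroup.closure_closure_coe_preimage
    (k := Set.range (primeGenerator S))).ge.trans ((AddSubgroup.closure_le _).2 ?_))
  rintro ⟨x, hx⟩ ⟨n, rfl⟩
  cases n with
  | zero =>
    have h0 : (⟨primeGenerator S 0, hx⟩ : primeSum S) = 0 :=
      Subtype.ext (funext fun q => if_neg fun h => q.2.ne_zero h.2)
    exact Set.mem_of_eq_of_mem h0 (AddSubgroup.zero_mem _)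
  | succ n => exact AddSubgroup.subset_closure ⟨n, rfl⟩

theorem primeSum_apply_eq_zero {S : Set PrimeNumber} {x : ∀ q : PrimeNumber, ZMod q}
    (hx : x ∈ primeSum S) {q : PrimeNumber} (hq : q ∉ S) : x q = 0 := by
  induction hx using AddSubgroup.closure_induction with
  | mem x hx =>
    obtain ⟨n, rfl⟩ := hx
    exact if_neg fun h => hq h.1
  | zero => rfl
  | add x y _ _ hx hy => rw [Pi.add_apply, hx, hy, add_zero]
  | neg x _ hx => rw [Pi.neg_apply, hx, neg_zero]

open Classical in
theorem exists_torsion_primeSum_iff (S : Set PrimeNumber) (p : PrimeNumber) :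
    (∃ x : primeSum S, (p : ℕ) • x = 0 ∧ x ≠ 0) ↔ p ∈ S := by
  constructor
  · rintro ⟨⟨x, hx⟩, hpx, hx0⟩
    -- A non-zero coordinate in the field `ZMod q` that is killed by `p` forces `q = p`.
    obtain ⟨q, hq⟩ : ∃ q, x q ≠ 0 := by
      by_contra! h
      exact hx0 (Subtype.ext (funext h))
    have hpq : (p : ℕ) • x q = 0 := congrFun (congrArg Subtype.val hpx) q
    have : Fact (q : ℕ).Prime := ⟨q.2⟩
    rw [nsmul_eq_mul, mul_eq_zero, or_iff_left hq, ZMod.natCast_eq_zero_iff,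
      Nat.prime_dvd_prime_iff_eq q.2 p.2] at hpq
    have hqp : q = p := Subtype.ext hpq
    by_contra hp
    exact hq (primeSum_apply_eq_zero hx (hqp ▸ hp))
  · intro hp
    refine ⟨primeSumGenerator S p, Subtype.ext (funext fun q => ?_), fun h => ?_⟩
    · change (p : ℕ) • (if _ then _ else _) = (0 : ZMod q)
      split_ifs with h
      · rw [nsmul_one, ← h.2, ZMod.natCast_self]
      · rw [smul_zero]
    · have h1 : (if p ∈ S ∧ (p : ℕ) = p then (1 : ZMod p) else 0) = 0 :=
        congrFun (congrArg Subtype.val h) p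
      rw [if_pos ⟨hp, rfl⟩] at h1
      have : Fact (p : ℕ).Prime := ⟨p.2⟩
      exact one_ne_zero h1

end PrimeSum

/-! ### The continuum of sets of primes, and the main theorem -/

theorem nonempty_real_equiv_set_primes : Nonempty (ℝ ≃ Set PrimeNumber) := by
  have : Infinite PrimeNumber := Nat.infinite_setOfPred_prime.to_subtype
  rw [← Cardinal.eq, Cardinal.mk_real, Cardinal.mk_set, Cardinal.mk_eq_aleph0,
    Cardinal.two_power_aleph0]

end

theorem mainTheorem5 :
    -- the group `G = M_∞ ⋊ ℤ`
    (Group.FG ShiftExtension ∧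
      IsElementaryAmenable ShiftExtension ∧
      SatisfiesIteratedIdentity commWord ShiftExtension ∧
      SatisfiesIteratedIdentity commWord' ShiftExtension ∧
      (∀ (n : ℕ) (w : FreeGroup (Fin (n + 1))), w ≠ 1 →
        SatisfiesIteratedIdentity w ShiftExtension → iterDepth w ShiftExtension = ⊤) ∧
      IsFractalWrtIdentities ShiftExtension) ∧
    -- a continuum of pairwise non-isomorphic groups
    (∃ (H : ℝ → Type) (_ : ∀ r, Group (H r)),
      (∀ r s, r ≠ s → IsEmpty (H r ≃* H s)) ∧
      ∀ r, Group.FG (H r) ∧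
        IsElementaryAmenable (H r) ∧
        IsFractalWrtIdentities (H r) ∧
        ∀ (n : ℕ) (w : FreeGroup (Fin n)), w ≠ 1 → ¬ SatisfiesIdentity w (H r)) := by
  have hG := ShiftExtension.isLocallyNilpotentByAbelian
  have hdepth : ∀ {n : ℕ} {w : FreeGroup (Fin (n + 1))}, w ≠ 1 → iterDepth w ShiftExtension = ⊤ :=
    fun hw => iterDepth_eq_top_of_injective SemidirectProduct.inl SemidirectProduct.inl_injective hw
  refine ⟨⟨ShiftExtension.fg, .shiftExtension, hG.commWord, hG.commWord', fun n w hw _ => hdepth hw,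
    isFractalWrtIdentities_of_iterDepth_eq_top commWord_ne_one hG.commWord
      (hdepth commWord_ne_one)⟩, ?_⟩
  obtain ⟨S⟩ := nonempty_real_equiv_set_primes
  -- The first factor contains `M_∞`, which forces infinite depth and excludes identities. The
  -- second encodes `S r` in its central torsion.
  refine ⟨fun r => ShiftExtension × HallGroup (primeSumGenerator (S r)), fun r => inferInstance,
    fun r s hrs => ⟨fun e => hrs (S.injective (Set.ext fun p => ?_))⟩, fun r => ?_⟩
  · rw [← exists_torsion_primeSum_iff, ← exists_torsion_primeSum_iff,
      ← hasCentralTorsion_prod_hallGroup_iff (primeSumGenerator (S r)) p.2.ne_zero,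
      ← hasCentralTorsion_prod_hallGroup_iff (primeSumGenerator (S s)) p.2.ne_zero]
    exact ⟨.of_mulEquiv e, .of_mulEquiv e.symm⟩
  · have := ShiftExtension.fg
    have := HallGroup.fg _ (closure_primeSumGenerator (S r))
    let f : UniTri →* ShiftExtension × HallGroup (primeSumGenerator (S r)) :=
      (MonoidHom.inl _ _).comp SemidirectProduct.inl
    have hf : Function.Injective f := fun u v h =>
      SemidirectProduct.inl_injective (congrArg Prod.fst h)
    exact ⟨inferInstance, .prod .shiftExtension (HallGroup.isElementaryAmenable _),
      isFractalWrtIdentities_of_iterDepth_eq_top commWord_ne_one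
        (hG.prod (HallGroup.isLocallyNilpotentByAbelian _)).commWord
        (iterDepth_eq_top_of_injective f hf commWord_ne_one),
      fun n w hw => not_satisfiesIdentity_of_injective f hf hw⟩
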